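/- **Binary trees.** For $n\ge 0$, let $\mathcal T_n$ be the set of binary trees with vertex set $[n]=\{1,\dots,n\}$ that satisfy the search tree property (every vertex is larger than all its left descendants and smaller than all its right descendants). For a vertex $i$, let $c_L(i)$, $c_R(i)$ and $p(i)$ be its left child, right child and parent (if they exist), and let $L(i)$, $R(i)$ be its left and right subtree. **Tree patterns.** A tree pattern is a pair $(P,e)$ where $P\in\mathcal T_k$ and $e$ assigns a value in $\{0,1\}$ to every non-root vertex of $P$. A tree $T\in\mathcal T_n$ contains $(P,e)$ if there is an injection $f:[k]\to[n]$ such that for every edge $(i,p(i))$ of $P$: if $e(i)=1$, then $f(i)=c_L(f(p(i)))$ if $i=c_L(p(i))$, and $f(i)=c_R(f(p(i)))$ if $i=c_R(p(i))$; if $e(i)=0$, then $f(i)\in L(f(p(i)))$ if $i=c_L(p(i))$, and $f(i)\in R(f(p(i)))$ if $i=c_R(p(i))$. Otherwise $T$ avoids $(P,e)$. Let $\mathcal T_n((P_1,e_1),\dots,(P_\ell,e_\ell))$ be the set of all $T\in\mathcal T_n$ that avoid each of the patterns $(P_1,e_1),\dots,(P_\ell,e_\ell)$. The pattern $(P,e)$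 is *friendly* if (i) the largest vertex $k$ is not the root of $P$ and has a left child; (ii) $e(j)=0$ for every vertex $j$ that lies on the maximal right branch of $P$ starting at the root (i.e. is reached from the root by right-child steps only) and is neither the first nor the last vertex of this branch; (iii) if $e(k)=1$, then $e(c_L(k))=0$. **Slides.** If $j=c_R(i)$, the up-rotation of $j$ rotates the edge $(i,j)$: $j$ takes the place of $i$, $i$ becomes the left child of $j$, and the former left subtree of $j$ becomes the right subtree of $i$. The down-rotation of $j$ is the inverse operation. An up-slide (down-slide) of $j$ by $d\ge 1$ steps is a sequence of $d$ up-rotations (down-rotations) of $j$. Given $\mathcal L_n\subseteq\mathcal T_n$, a slide is *minimal* if every slide of the same vertex in the same direction by fewer (at least one) steps creates a tree not in $\mathcal L_n$. **Algorithm S** on $\mathcal L_n$ with initial tree $T_0$: visit $T_0$. Then repeatedly generate an unvisited tree of $\mathcal L_n$ by performing, in the most recently visited tree, a minimal slide of the largest possible vertex; if no such slide exists, or if the direction of this slide is ambiguous, terminate; otherwise visit the tree generated and continue. **Theorem.** Let $n,\ell\ge 0$ and let $(P_1,e_1),\dots,(P_\ell,e_\ell)$ be friendly tree patterns. Then Algorithm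 S on $\mathcal L_n=\mathcal T_n((P_1,e_1),\dots,(P_\ell,e_\ell))$, with the right path in $\mathcal T_n$ (the tree in which no vertex has a left child) as initial tree, terminates, and it visits every tree of $\mathcal T_n((P_1,e_1),\dots,(P_\ell,e_\ell))$ exactly once and no other tree. -/

import Mathlib

namespace PatTree

/-! ### Binary trees with the search tree property -/

/-- The set of vertices (labels) of a tree. -/
def verts : BinaryTree ℕ → Finset ℕ
  | .nil => ∅
  | .node x l r => insert x (verts l ∪ verts r)

/-- The search tree property: left descendants of a vertex are smaller than it, right descendants
are larger than it. -/
def IsSearchTree : BinaryTree ℕ → Prop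
  | .nil => True
  | .node x l r =>
      IsSearchTree l ∧ IsSearchTree r ∧ (∀ y ∈ verts l, y < x) ∧ (∀ y ∈ verts r, x < y)

/-- `𝒯 n`: the binary trees with vertex set `{1, …, n}` and the search tree property. -/
def binTrees (n : ℕ) : Set (BinaryTree ℕ) :=
  {T | IsSearchTree T ∧ verts T = Finset.Icc 1 n}

/-- The root `r(T)`, or `none` for the empty tree. -/
def root : BinaryTree ℕ → Option ℕ
  | .nil => none
  | .node x _ _ => some x

/-- `T(i)`: the subtree of the search tree `T` rooted at the vertex `i`
(the empty tree if `i` is not a vertex of `T`). -/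
def subtreeAt : BinaryTree ℕ → ℕ → BinaryTree ℕ
  | .nil, _ => .nil
  | .node x l r, i =>
      if i = x then .node x l r else if i < x then subtreeAt l i else subtreeAt r i

/-- `L(i)`: the left subtree of the vertex `i` in `T`. -/
def leftSub (T : BinaryTree ℕ) (i : ℕ) : BinaryTree ℕ := (subtreeAt T i).left

/-- `R(i)`: the right subtree of the vertex `i` in `T`. -/
def rightSub (T : BinaryTree ℕ) (i : ℕ) : BinaryTree ℕ := (subtreeAt T i).right

/-- `c_L(i)`: the left child of the vertex `i` in `T`, or `none`. -/
def leftChild (T : BinaryTree ℕ) (i : ℕ) : Option ℕ := root (leftSub T i)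

/-- `c_R(i)`: the right child of the vertex `i` in `T`, or `none`. -/
def rightChild (T : BinaryTree ℕ) (i : ℕ) : Option ℕ := root (rightSub T i)

/-- `p(i) = q` in `T`. -/
def IsParent (T : BinaryTree ℕ) (q i : ℕ) : Prop :=
  leftChild T q = some i ∨ rightChild T q = some i

/-- The vertices of the right branch starting at the root of `T`, from top to bottom. -/
def rightBranch : BinaryTree ℕ → List ℕ
  | .nil => []
  | .node x _ r => x :: rightBranch r

/-- `τ(T)`: the sequence of labels in a preorder traversal. -/
def preorder : BinaryTree ℕ → List ℕ
  | .nil => []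
  | .node x l r => x :: (preorder l ++ preorder r)

/-! ### Tree patterns -/

/-- A tree pattern `(P, e)` with `P ∈ 𝒯 k`. For a non-root vertex `i`, the edge from `i` to its
parent is contiguous (`e(i) = 1`) if `contig i = true`, and non-contiguous (`e(i) = 0`) if
`contig i = false`. Values of `contig` at the root and outside of `{1, …, k}` play no role. -/
structure TreePattern where
  k : ℕ
  P : BinaryTree ℕ
  mem : P ∈ binTrees k
  contig : ℕ → Bool

/-- The tree `T` contains the tree pattern `p`: there is an injection from the vertices of the
pattern to those of `T` that maps contiguous edges to edges of the same type (left or right), and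
the lower end of a non-contiguous edge to a left or right descendant, respectively, of the image
of its upper end. -/
def Contains (T : BinaryTree ℕ) (p : TreePattern) : Prop :=
  ∃ f : ℕ → ℕ,
    Set.MapsTo f (verts p.P) (verts T) ∧ Set.InjOn f (verts p.P) ∧
    (∀ q i, leftChild p.P q = some i →
      if p.contig i then leftChild T (f q) = some (f i) else f i ∈ verts (leftSub T (f q))) ∧
    (∀ q i, rightChild p.P q = some i →
      if p.contig i then rightChild T (f q) = some (f i) else f i ∈ verts (rightSub T (f q)))

/-- `𝒯 n ((P₁, e₁), …, (P_ℓ, e_ℓ))`: the trees in `𝒯 n` that avoid all the given patterns. -/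
def avoiders (n : ℕ) {l : ℕ} (p : Fin l → TreePattern) : Set (BinaryTree ℕ) :=
  {T ∈ binTrees n | ∀ i, ¬ Contains T (p i)}

/-- Friendly tree patterns: (i) the largest vertex `k` is neither the root nor a leaf, that is, it
has a parent and a left child; (ii) the edges on the right branch starting at the root, except
possibly the last one, are all non-contiguous; (iii) if the edge from `k` to its parent is
contiguous, then the edge from `k` to its left child is not. -/
structure Friendly (p : TreePattern) : Prop where
  parent_ne : ∃ q, IsParent p.P q p.k
  leftChild_ne : leftChild p.P p.k ≠ none
  branch : ∀ j ∈ (rightBranch p.P).dropLast, root p.P ≠ some j → p.contig j = false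
  last : p.contig p.k = true → ∀ c, leftChild p.P p.k = some c → p.contig c = false

/-! ### Rotations and slides -/

/-- `UpRot j T T'`: the tree `T'` is obtained from `T` by the up-rotation of the vertex `j`, i.e. by
rotating the edge `(i, j)`, where `j` is the right child of its parent `i`. -/
inductive UpRot (j : ℕ) : BinaryTree ℕ → BinaryTree ℕ → Prop
  | rot (i : ℕ) (X Y Z : BinaryTree ℕ) :
      UpRot j (.node i X (.node j Y Z)) (.node j (.node i X Y) Z)
  | left (x : ℕ) {l l' : BinaryTree ℕ} (r : BinaryTree ℕ) :
      UpRot j l l' → UpRot j (.node x l r) (.node x l' r)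
  | right (x : ℕ) (l : BinaryTree ℕ) {r r' : BinaryTree ℕ} :
      UpRot j r r' → UpRot j (.node x l r) (.node x l r')

/-- The two directions of rotations and slides. -/
inductive Dir
  | up
  | down

/-- A rotation of the vertex `j` in a given direction; down-rotation of `j` is the inverse
operation of up-rotation of `j`. -/
def Rot : Dir → ℕ → BinaryTree ℕ → BinaryTree ℕ → Prop
  | .up, j, T, T' => UpRot j T T'
  | .down, j, T, T' => UpRot j T' T

/-- `Slide dir j d T T'`: the tree `T'` is obtained from `T` by a slide of the vertex `j` by
`d` steps in direction `dir`, i.e. by a sequence of `d` rotations of `j` in this direction. -/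
inductive Slide (dir : Dir) (j : ℕ) : ℕ → BinaryTree ℕ → BinaryTree ℕ → Prop
  | zero (T : BinaryTree ℕ) : Slide dir j 0 T T
  | succ {d : ℕ} {T T' T'' : BinaryTree ℕ} :
      Slide dir j d T T' → Rot dir j T' T'' → Slide dir j (d + 1) T T''

/-- `T'` is obtained from `T` by a slide of `j` in direction `dir` (by at least one step) that is
minimal w.r.t. `S`: every slide of `j` in the same direction by fewer (but at least one) steps
creates a tree that is not in `S`. -/
def MinimalSlide (S : Set (BinaryTree ℕ)) (dir : Dir) (j : ℕ) (T T' : BinaryTree ℕ) : Prop :=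
  ∃ d, 1 ≤ d ∧ Slide dir j d T T' ∧
    ∀ d', 1 ≤ d' → d' < d → ∀ T'', Slide dir j d' T T'' → T'' ∉ S

/-! ### Algorithm S (greedy minimal slides) -/

/-- When the trees visited so far are those in the list `V` and the last one of them is `T`, the
tree `T'` is an unvisited tree from `S` that is generated from `T` by a minimal slide of the vertex
`j` in direction `dir`. -/
def Candidate (S : Set (BinaryTree ℕ)) (V : List (BinaryTree ℕ)) (T : BinaryTree ℕ)
    (j : ℕ) (dir : Dir) (T' : BinaryTree ℕ) : Prop :=
  T' ∈ S ∧ T' ∉ V ∧ MinimalSlide S dir j T T'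

/-- The slide step: in this situation the algorithm visits the tree `T'` next. The slide uses the
largest possible vertex `j`, and its direction is unambiguous. -/
def Step (S : Set (BinaryTree ℕ)) (V : List (BinaryTree ℕ)) (T T' : BinaryTree ℕ) : Prop :=
  ∃ j dir, Candidate S V T j dir T' ∧
    (∀ j' dir' T'', Candidate S V T j' dir' T'' → j' ≤ j) ∧
    (∀ dir' T'', Candidate S V T j dir' T'' → dir' = dir)

/-- `Reached S T₀ V`: when the algorithm runs on the set `S` with initial tree `T₀`, then at some
point the sequence of visited trees, the most recently visited one first, is `V`. -/
inductive Reached (S : Set (BinaryTree ℕ)) (T₀ : BinaryTree ℕ) : List (BinaryTree ℕ) → Prop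
  | init : Reached S T₀ [T₀]
  | step {T T' : BinaryTree ℕ} {V : List (BinaryTree ℕ)} :
      Reached S T₀ (T :: V) → Step S (T :: V) T T' → Reached S T₀ (T' :: T :: V)

/-- `Output S T₀ V`: the algorithm, run on the set `S` with initial tree `T₀`, terminates, and `V`
is the sequence of all visits that it has made, in reverse order. -/
def Output (S : Set (BinaryTree ℕ)) (T₀ : BinaryTree ℕ) (V : List (BinaryTree ℕ)) : Prop :=
  Reached S T₀ V ∧ ¬ ∃ T', Reached S T₀ (T' :: V)

/-! ### The initial tree -/

/-- The right path with the `m` vertices `a, a + 1, …, a + m - 1`. -/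
def rightPathFrom : ℕ → ℕ → BinaryTree ℕ
  | _, 0 => .nil
  | a, m + 1 => .node a .nil (rightPathFrom (a + 1) m)

/-- The right path in `𝒯 n`. -/
def rightPath (n : ℕ) : BinaryTree ℕ := rightPathFrom 1 n

theorem mem_verts_rightPathFrom (m a y : ℕ) :
    y ∈ verts (rightPathFrom a m) ↔ a ≤ y ∧ y < a + m := by
  induction m generalizing a with
  | zero => simp [rightPathFrom, verts]
  | succ m ih => simp only [rightPathFrom, verts, Finset.mem_insert, Finset.mem_union, ih,
      Finset.notMem_empty, false_or]; omega

theorem isSearchTree_rightPathFrom (m a : ℕ) : IsSearchTree (rightPathFrom a m) := by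
  induction m generalizing a with
  | zero => simp [rightPathFrom, IsSearchTree]
  | succ m ih =>
    refine ⟨trivial, ih _, by simp [verts], fun y hy => ?_⟩
    rw [mem_verts_rightPathFrom] at hy
    omega

theorem rightPath_mem (n : ℕ) : rightPath n ∈ binTrees n := by
  refine ⟨isSearchTree_rightPathFrom n 1, ?_⟩
  ext y
  rw [rightPath, mem_verts_rightPathFrom, Finset.mem_Icc]
  omega

theorem preorder_rightPathFrom (m a : ℕ) : preorder (rightPathFrom a m) = List.range' a m := by
  induction m generalizing a with
  | zero => rfl
  | succ m ih => simp [rightPathFrom, preorder, ih, List.range'_succ]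

/-- The preorder permutation of the right path is the identity permutation. -/
theorem preorder_rightPath (n : ℕ) : preorder (rightPath n) = List.range' 1 n :=
  preorder_rightPathFrom n 1

end PatTree

/-!
The proof is by induction on the number of vertices. A search tree on `n + 1` vertices arises in
exactly one way from a tree `T` on `n` vertices by inserting the largest vertex `n + 1` at some
position of the right branch of `T` (`insertMax`, `deleteMax`), and the rotations of `n + 1` move it
by one position along this branch.

Friendliness is used only to show that the avoiders of the given patterns on `n + 1` vertices are a
*zigzag extension* of those on `n` vertices (`isZigzagExtension_avoiders`): deleting the largest
vertex preserves avoidance, and so does inserting it as the root or as a leaf. Inserting it as the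
root (as a leaf) creates no occurrence of a pattern, because the largest vertex of the pattern is
not its root (has a left child). Conversely, an insertion into a tree that contains a pattern can
only break the edge between the largest vertex `k` of the pattern and its parent, and then the
inserted vertex serves as a new image of `k` (`Friendly.contains_insertMax`).

For a zigzag extension `S` of `S'`, a run of the algorithm on `S'` lifts to one on `S`
(`IsZigzagExtension.reached_lift`). When the algorithm on `S` meets the first tree that arises from
`T`, the vertex `n + 1` is the root or a leaf; as it is the largest vertex, its slides take
precedence, and it sweeps to the other end of the right branch of `T`, visiting all trees in `S`
that arise from `T` (`Reached.sweep`). Then all its slides lead to visited trees, and since it is a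
leaf or the root, the slides of the other vertices are the same as those in `T`; so the algorithm
moves on as it does on `S'` (`IsZigzagExtension.step_lift`). As the algorithm is deterministic on
search trees (`Output.unique`), every terminated run is the one obtained in this way.
-/

namespace PatTree

/-! ### Inserting and deleting the largest vertex -/

/-- The number of vertices on the right branch starting at the root. -/
def branchLength : BinaryTree ℕ → ℕ
  | .nil => 0
  | .node _ _ r => branchLength r + 1

/-- Insertion of the vertex `n`, meant to be larger than all vertices of the tree, below the first
`t` vertices of the right branch: the rest of the branch, with everything that hangs off it,
becomes the left subtree of `n`. For `t = 0`, the vertex `n` becomes the root; for `t` the length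
of the branch (and for all larger `t`) it becomes a leaf. -/
def insertMax : BinaryTree ℕ → ℕ → ℕ → BinaryTree ℕ
  | T, n, 0 => .node n T .nil
  | .nil, n, _ + 1 => .node n .nil .nil
  | .node x l r, n, t + 1 => .node x l (insertMax r n t)

/-- Deletion of the last vertex of the right branch, which is replaced by its left subtree. In a
search tree this is the largest vertex. -/
def deleteMax : BinaryTree ℕ → BinaryTree ℕ
  | .nil => .nil
  | .node _ l .nil => l
  | .node x l (.node y a b) => .node x l (deleteMax (.node y a b))

theorem insertMax_ne_nil (T : BinaryTree ℕ) (n t : ℕ) : insertMax T n t ≠ .nil := by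
  cases T <;> cases t <;> simp [insertMax]

theorem deleteMax_node {r : BinaryTree ℕ} (x : ℕ) (l : BinaryTree ℕ) (hr : r ≠ .nil) :
    deleteMax (.node x l r) = .node x l (deleteMax r) := by
  cases r
  · exact absurd rfl hr
  · rfl

theorem deleteMax_insertMax (T : BinaryTree ℕ) (n t : ℕ) : deleteMax (insertMax T n t) = T := by
  induction T generalizing t with
  | nil => cases t <;> rfl
  | node x l r _ ih =>
    cases t with
    | zero => rfl
    | succ t => rw [insertMax, deleteMax_node _ _ (insertMax_ne_nil _ _ _), ih]

theorem branchLength_insertMax {T : BinaryTree ℕ} {n t : ℕ} (ht : t ≤ branchLength T) :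
    branchLength (insertMax T n t) = t + 1 := by
  induction T generalizing t with
  | nil => cases t <;> simp_all [insertMax, branchLength]
  | node x l r _ ih =>
    cases t with
    | zero => rfl
    | succ t =>
      simp only [branchLength, insertMax] at ht ⊢
      rw [ih (by omega)]

theorem verts_insertMax (T : BinaryTree ℕ) (n t : ℕ) :
    verts (insertMax T n t) = insert n (verts T) := by
  induction T generalizing t with
  | nil => cases t <;> simp [insertMax, verts]
  | node x l r _ ih =>
    cases t with
    | zero => simp [insertMax, verts]
    | succ t => ext y; simp only [insertMax, verts, ih, Finset.mem_insert, Finset.mem_union]; tauto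

theorem isSearchTree_insertMax {T : BinaryTree ℕ} {n : ℕ} (t : ℕ) (hT : IsSearchTree T)
    (hn : ∀ y ∈ verts T, y < n) : IsSearchTree (insertMax T n t) := by
  induction T generalizing t with
  | nil => cases t <;> simp [insertMax, IsSearchTree, verts]
  | node x l r _ ih =>
    cases t with
    | zero => simp_all [insertMax, IsSearchTree, verts]
    | succ t =>
      simp only [IsSearchTree, verts, Finset.mem_insert, Finset.mem_union] at hT hn
      refine ⟨hT.1, ih t hT.2.1 fun y hy => hn y (.inr (.inr hy)), hT.2.2.1, fun y hy => ?_⟩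
      rw [verts_insertMax, Finset.mem_insert] at hy
      rcases hy with rfl | hy
      · exact hn x (.inl rfl)
      · exact hT.2.2.2 y hy

theorem exists_eq_insertMax {T : BinaryTree ℕ} {n : ℕ} (hT : IsSearchTree T) (hn : n ∈ verts T)
    (hmax : ∀ y ∈ verts T, y ≤ n) :
    ∃ T' t, t ≤ branchLength T' ∧ T = insertMax T' n t ∧ IsSearchTree T' ∧ n ∉ verts T' := by
  induction T with
  | nil => simp [verts] at hn
  | node x l r _ ih =>
    simp only [IsSearchTree, verts, Finset.mem_insert, Finset.mem_union] at hT hn hmax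
    obtain ⟨hl, hr, hlx, hrx⟩ := hT
    have hnl : n ∉ verts l := fun h => by
      have := hlx n h
      have := hmax x (.inl rfl)
      omega
    by_cases hrn : n ∈ verts r
    · obtain ⟨T', t, ht, rfl, hT', hnT'⟩ := ih hr hrn fun y hy => hmax y (.inr (.inr hy))
      refine ⟨.node x l T', t + 1, by simpa [branchLength] using ht, rfl, ?_, ?_⟩
      · exact ⟨hl, hT', hlx, fun y hy => hrx y (by rw [verts_insertMax]; simp [hy])⟩
      · have := hrx n hrn
        simp only [verts, Finset.mem_insert, Finset.mem_union, hnl, hnT', or_false]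
        omega
    · have hnx : n = x := by tauto
      subst hnx
      have hr0 : r = .nil := by
        cases r with
        | nil => rfl
        | node y a b =>
          have h1 := hrx y (by simp [verts])
          have h2 := hmax y (.inr (.inr (by simp [verts])))
          omega
      subst hr0
      exact ⟨l, 0, Nat.zero_le _, by cases l <;> rfl, hl, hnl⟩

theorem insertMax_zero (T : BinaryTree ℕ) (n : ℕ) : insertMax T n 0 = .node n T .nil := by
  cases T <;> rfl

theorem insertMax_mem {T : BinaryTree ℕ} {n : ℕ} (t : ℕ) (hT : T ∈ binTrees n) :
    insertMax T (n + 1) t ∈ binTrees (n + 1) := by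
  refine ⟨isSearchTree_insertMax t hT.1 fun y hy => ?_, ?_⟩
  · rw [hT.2, Finset.mem_Icc] at hy
    omega
  · rw [verts_insertMax, hT.2]
    ext y
    simp only [Finset.mem_insert, Finset.mem_Icc]
    omega

theorem exists_eq_insertMax_of_mem {T : BinaryTree ℕ} {n : ℕ} (hT : T ∈ binTrees (n + 1)) :
    ∃ T' t, t ≤ branchLength T' ∧ T = insertMax T' (n + 1) t ∧ T' ∈ binTrees n := by
  obtain ⟨T', t, ht, rfl, hs, hn⟩ := exists_eq_insertMax (n := n + 1) hT.1
    (by rw [hT.2]; simp) (fun y hy => by rw [hT.2, Finset.mem_Icc] at hy; exact hy.2)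
  refine ⟨T', t, ht, rfl, hs, ?_⟩
  have h := hT.2
  rw [verts_insertMax] at h
  rw [← Finset.erase_insert hn, h]
  ext y
  simp only [Finset.mem_erase, Finset.mem_Icc]
  omega

theorem rightPathFrom_succ (a m : ℕ) :
    rightPathFrom a (m + 1) =
      insertMax (rightPathFrom a m) (a + m) (branchLength (rightPathFrom a m)) := by
  induction m generalizing a with
  | zero => rfl
  | succ m ih =>
    rw [rightPathFrom, ih (a + 1), rightPathFrom, branchLength, insertMax, Nat.add_right_comm]
    rfl

theorem rightPath_succ (n : ℕ) :
    rightPath (n + 1) = insertMax (rightPath n) (n + 1) (branchLength (rightPath n)) := by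
  rw [rightPath, rightPathFrom_succ, Nat.add_comm 1 n]
  rfl

/-! ### Rotations -/

theorem UpRot.mem_left {j : ℕ} {T T' : BinaryTree ℕ} (h : UpRot j T T') : j ∈ verts T := by
  induction h <;> simp_all [verts]

theorem UpRot.verts_eq {j : ℕ} {T T' : BinaryTree ℕ} (h : UpRot j T T') :
    verts T = verts T' := by
  induction h with
  | rot i X Y Z => ext y; simp only [verts, Finset.mem_insert, Finset.mem_union]; tauto
  | left x r _ ih => simp [verts, ih]
  | right x l _ ih => simp [verts, ih]

theorem UpRot.isSearchTree_iff {j : ℕ} {T T' : BinaryTree ℕ} (h : UpRot j T T') :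
    IsSearchTree T ↔ IsSearchTree T' := by
  induction h with
  | rot i X Y Z =>
    simp only [IsSearchTree, verts, Finset.mem_insert, Finset.mem_union, or_imp, forall_and,
      forall_eq]
    constructor
    · rintro ⟨hX, ⟨hY, hZ, hYj, hZj⟩, hXi, hij, hYi, hZi⟩
      exact ⟨⟨hX, hY, hXi, hYi⟩, hZ, ⟨hij, fun y hy => (hXi y hy).trans hij, hYj⟩, hZj⟩
    · rintro ⟨⟨hX, hY, hXi, hYi⟩, hZ, ⟨hij, _, hYj⟩, hZj⟩
      exact ⟨hX, ⟨hY, hZ, hYj, hZj⟩, hXi, hij, hYi, fun y hy => hij.trans (hZj y hy)⟩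
  | left x r h ih => simp only [IsSearchTree, ih, h.verts_eq]
  | right x l h ih => simp only [IsSearchTree, ih, h.verts_eq]

/-- In a search tree the label determines the vertex, so the up-rotation of `j` is unique. -/
theorem UpRot.right_unique {j : ℕ} {T A B : BinaryTree ℕ} (hT : IsSearchTree T)
    (hA : UpRot j T A) (hB : UpRot j T B) : A = B := by
  induction hA generalizing B with
  | rot i X Y Z =>
    simp only [IsSearchTree, verts, Finset.mem_insert, Finset.mem_union] at hT
    obtain ⟨-, ⟨-, -, hY, hZ⟩, hX, hi⟩ := hT
    have hij := hi j (.inl rfl)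
    cases hB with
    | rot => rfl
    | left _ _ h => have := hX j h.mem_left; omega
    | right _ _ h =>
      cases h with
      | rot => exact absurd (hZ j (by simp [verts])) (lt_irrefl _)
      | left _ _ h => exact absurd (hY j h.mem_left) (lt_irrefl _)
      | right _ _ h => exact absurd (hZ j h.mem_left) (lt_irrefl _)
  | left x r h ih =>
    obtain ⟨hl, hr, hlx, hrx⟩ := hT
    have hjx := hlx j h.mem_left
    cases hB with
    | rot => have := hrx j (by simp [verts]); omega
    | left _ _ h' => rw [ih hl h']
    | right _ _ h' => have := hrx j h'.mem_left; omega
  | right x l h ih =>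
    obtain ⟨hl, hr, hlx, hrx⟩ := hT
    have hjx := hrx j h.mem_left
    cases hB with
    | rot i X Y Z =>
      simp only [IsSearchTree] at hr
      cases h with
      | rot => exact absurd (hr.2.2.2 j (by simp [verts])) (lt_irrefl _)
      | left _ _ h => exact absurd (hr.2.2.1 j h.mem_left) (lt_irrefl _)
      | right _ _ h => exact absurd (hr.2.2.2 j h.mem_left) (lt_irrefl _)
    | left _ _ h' => have := hlx j h'.mem_left; omega
    | right _ _ h' => rw [ih hr h']

/-- In a search tree the label determines the vertex, so the down-rotation of `j` is unique. -/
theorem UpRot.left_unique {j : ℕ} {T A B : BinaryTree ℕ} (hT : IsSearchTree T)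
    (hA : UpRot j A T) (hB : UpRot j B T) : A = B := by
  induction hA generalizing B with
  | rot i X Y Z =>
    obtain ⟨-, -, hX, hZ⟩ := hT
    cases hB with
    | rot => rfl
    | left _ _ h => exact absurd (hX j (h.verts_eq ▸ h.mem_left)) (lt_irrefl _)
    | right _ _ h => exact absurd (hZ j (h.verts_eq ▸ h.mem_left)) (lt_irrefl _)
  | left x r h ih =>
    obtain ⟨hl, hr, hlx, hrx⟩ := hT
    have hjx := hlx j (h.verts_eq ▸ h.mem_left)
    cases hB with
    | rot => exact absurd hjx (lt_irrefl _)
    | left _ _ h' => rw [ih hl h']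
    | right _ _ h' => have := hrx j (h'.verts_eq ▸ h'.mem_left); omega
  | right x l h ih =>
    obtain ⟨hl, hr, hlx, hrx⟩ := hT
    have hjx := hrx j (h.verts_eq ▸ h.mem_left)
    cases hB with
    | rot => exact absurd hjx (lt_irrefl _)
    | left _ _ h' => have := hlx j (h'.verts_eq ▸ h'.mem_left); omega
    | right _ _ h' => rw [ih hr h']

theorem Rot.mem {dir : Dir} {j : ℕ} {T T' : BinaryTree ℕ} (h : Rot dir j T T') :
    j ∈ verts T := by
  cases dir with
  | up => exact UpRot.mem_left h
  | down => exact UpRot.verts_eq h ▸ UpRot.mem_left h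

theorem Rot.isSearchTree {dir : Dir} {j : ℕ} {T T' : BinaryTree ℕ} (h : Rot dir j T T')
    (hT : IsSearchTree T) : IsSearchTree T' := by
  cases dir with
  | up => exact (UpRot.isSearchTree_iff h).1 hT
  | down => exact (UpRot.isSearchTree_iff h).2 hT

theorem Rot.unique {dir : Dir} {j : ℕ} {T A B : BinaryTree ℕ} (hT : IsSearchTree T)
    (hA : Rot dir j T A) (hB : Rot dir j T B) : A = B := by
  cases dir with
  | up => exact UpRot.right_unique hT hA hB
  | down => exact UpRot.left_unique hT hA hB

theorem Slide.mem {dir : Dir} {j d : ℕ} {T T' : BinaryTree ℕ} (h : Slide dir j d T T')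
    (hd : 1 ≤ d) : j ∈ verts T := by
  induction h with
  | zero => omega
  | succ h hr ih =>
    cases h with
    | zero => exact hr.mem
    | succ => exact ih (by omega)

theorem Slide.isSearchTree {dir : Dir} {j d : ℕ} {T T' : BinaryTree ℕ} (h : Slide dir j d T T')
    (hT : IsSearchTree T) : IsSearchTree T' := by
  induction h with
  | zero => exact hT
  | succ _ hr ih => exact hr.isSearchTree (ih hT)

theorem Slide.unique {dir : Dir} {j d : ℕ} {T A B : BinaryTree ℕ} (hT : IsSearchTree T)
    (hA : Slide dir j d T A) (hB : Slide dir j d T B) : A = B := by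
  induction hA generalizing B with
  | zero => cases hB; rfl
  | succ h hr ih =>
    cases hB with
    | succ h' hr' =>
      obtain rfl := ih hT h'
      exact hr.unique (h.isSearchTree hT) hr'

/-! ### Rotations of the largest vertex -/

theorem upRot_insertMax (T : BinaryTree ℕ) (n : ℕ) {t : ℕ} (ht : t < branchLength T) :
    UpRot n (insertMax T n (t + 1)) (insertMax T n t) := by
  induction T generalizing t with
  | nil => simp [branchLength] at ht
  | node x l r _ ih =>
    cases t with
    | zero => rw [insertMax_zero, insertMax, insertMax_zero]; exact .rot ..
    | succ t => exact .right _ _ (ih (by simpa [branchLength] using ht))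

theorem eq_of_upRot_insertMax {T X : BinaryTree ℕ} {n t : ℕ} (hn : n ∉ verts T)
    (ht : t ≤ branchLength T) (h : UpRot n (insertMax T n t) X) :
    0 < t ∧ X = insertMax T n (t - 1) := by
  induction T generalizing t X with
  | nil =>
    obtain rfl : t = 0 := by simpa [branchLength] using ht
    cases h <;> rename_i h <;> cases h
  | node x l r _ ih =>
    simp only [verts, Finset.mem_insert, Finset.mem_union, not_or] at hn
    cases t with
    | zero =>
      rw [insertMax_zero] at h
      cases h with
      | left _ _ h => have := h.mem_left; simp [verts] at this; tauto
      | right _ _ h => cases h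
    | succ t =>
      simp only [branchLength, Nat.add_le_add_iff_right] at ht
      refine ⟨t.succ_pos, ?_⟩
      rw [insertMax] at h
      generalize hr : insertMax r n t = r' at h
      cases h with
      | rot _ _ Y Z =>
        cases t with
        | zero =>
          rw [insertMax_zero] at hr
          cases hr
          rfl
        | succ t =>
          cases r with
          | nil => simp [branchLength] at ht
          | node y a b =>
            rw [insertMax] at hr
            cases hr
            simp [verts] at hn
      | left _ _ h => exact absurd h.mem_left hn.2.1
      | right _ _ h =>
        obtain ⟨h0, rfl⟩ := ih hn.2.2 ht (hr ▸ h)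
        obtain ⟨t, rfl⟩ := Nat.exists_eq_succ_of_ne_zero h0.ne'
        rfl

theorem eq_of_upRot_insertMax_right {T X : BinaryTree ℕ} {n t : ℕ} (hn : n ∉ verts T)
    (ht : t ≤ branchLength T) (h : UpRot n X (insertMax T n t)) :
    t < branchLength T ∧ X = insertMax T n (t + 1) := by
  induction T generalizing t X with
  | nil =>
    obtain rfl : t = 0 := by simpa [branchLength] using ht
    cases h <;> rename_i h <;> cases h
  | node x l r _ ih =>
    simp only [verts, Finset.mem_insert, Finset.mem_union, not_or] at hn
    cases t with
    | zero =>
      rw [insertMax_zero] at h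
      cases h with
      | rot i X Y Z => exact ⟨Nat.succ_pos _, by rw [insertMax, insertMax_zero]⟩
      | left _ _ h => have := h.verts_eq ▸ h.mem_left; simp [verts] at this; tauto
      | right _ _ h => cases h
    | succ t =>
      simp only [branchLength, Nat.add_le_add_iff_right] at ht
      rw [insertMax] at h
      generalize hr : insertMax r n t = r' at h
      cases h with
      | rot => simp at hn
      | left _ _ h => exact absurd (h.verts_eq ▸ h.mem_left) hn.2.1
      | right _ _ h =>
        obtain ⟨h0, rfl⟩ := ih hn.2.2 ht (hr ▸ h)
        exact ⟨by simpa [branchLength] using h0, rfl⟩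

/-! ### Rotations of other vertices when the largest vertex is the root or a leaf -/

theorem rot_insertMax_zero {dir : Dir} {j n : ℕ} (hj : j ≠ n) {T Y : BinaryTree ℕ} :
    Rot dir j (insertMax T n 0) Y ↔ ∃ X, Y = insertMax X n 0 ∧ Rot dir j T X := by
  simp only [insertMax_zero]
  constructor
  · intro h
    cases dir with
    | up =>
      cases h with
      | left _ _ h => exact ⟨_, rfl, h⟩
      | right _ _ h => cases h
    | down =>
      cases h with
      | rot => exact absurd rfl hj
      | left _ _ h => exact ⟨_, rfl, h⟩
      | right _ _ h => cases h
  · rintro ⟨X, rfl, h⟩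
    cases dir with
    | up => exact .left _ _ h
    | down => exact .left _ _ h

theorem UpRot.insertMax_branchLength {j : ℕ} (n : ℕ) {T X : BinaryTree ℕ} (h : UpRot j T X) :
    UpRot j (insertMax T n (branchLength T)) (insertMax X n (branchLength X)) := by
  induction h with
  | rot => exact .rot ..
  | left _ _ h => exact .left _ _ h
  | right _ _ _ ih => exact .right _ _ ih

theorem eq_of_upRot_insertMax_branchLength {j n : ℕ} (hj : j ≠ n) {T Y : BinaryTree ℕ}
    (h : UpRot j (insertMax T n (branchLength T)) Y) :
    ∃ X, Y = insertMax X n (branchLength X) ∧ UpRot j T X := by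
  induction T generalizing Y with
  | nil => cases h <;> rename_i h <;> cases h
  | node x l r _ ih =>
    rw [branchLength, insertMax] at h
    generalize hr : insertMax r n (branchLength r) = r' at h
    cases h with
    | rot _ _ A B =>
      cases r with
      | nil => cases hr; exact absurd rfl hj
      | node y a b =>
        rw [branchLength, insertMax] at hr
        cases hr
        exact ⟨_, rfl, .rot ..⟩
    | left _ _ h => subst hr; exact ⟨_, rfl, .left _ r h⟩
    | right _ _ h =>
      obtain ⟨X, rfl, hX⟩ := ih (hr ▸ h)
      exact ⟨_, rfl, .right x l hX⟩

theorem eq_of_upRot_insertMax_branchLength_right {j n : ℕ} (hj : j ≠ n) {T Y : BinaryTree ℕ}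
    (h : UpRot j Y (insertMax T n (branchLength T))) :
    ∃ X, Y = insertMax X n (branchLength X) ∧ UpRot j X T := by
  induction T generalizing Y with
  | nil =>
    cases h with
    | left _ _ h => cases h
    | right _ _ h => cases h
  | node x l r _ ih =>
    rw [branchLength, insertMax] at h
    generalize hr : insertMax r n (branchLength r) = r' at h
    cases h with
    | rot i A B => subst hr; exact ⟨.node i A (.node j B r), rfl, .rot ..⟩
    | left _ _ h => subst hr; exact ⟨_, rfl, .left _ r h⟩
    | right _ _ h =>
      obtain ⟨X, rfl, hX⟩ := ih (hr ▸ h)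
      exact ⟨_, rfl, .right x l hX⟩

theorem rot_insertMax_branchLength {dir : Dir} {j n : ℕ} (hj : j ≠ n) {T Y : BinaryTree ℕ} :
    Rot dir j (insertMax T n (branchLength T)) Y ↔
      ∃ X, Y = insertMax X n (branchLength X) ∧ Rot dir j T X := by
  cases dir with
  | up =>
    refine ⟨eq_of_upRot_insertMax_branchLength hj, ?_⟩
    rintro ⟨X, rfl, h⟩
    exact UpRot.insertMax_branchLength n h
  | down =>
    refine ⟨eq_of_upRot_insertMax_branchLength_right hj, ?_⟩
    rintro ⟨X, rfl, h⟩
    exact UpRot.insertMax_branchLength n h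

/-- If the rotations of `j` commute with an operation `h` on trees, then so do the slides. -/
theorem slide_iff_of_rot_iff {dir : Dir} {j : ℕ} {h : BinaryTree ℕ → BinaryTree ℕ}
    (hrot : ∀ T Y, Rot dir j (h T) Y ↔ ∃ X, Y = h X ∧ Rot dir j T X)
    {d : ℕ} {T Y : BinaryTree ℕ} :
    Slide dir j d (h T) Y ↔ ∃ X, Y = h X ∧ Slide dir j d T X := by
  induction d generalizing Y with
  | zero =>
    constructor
    · intro hs
      cases hs
      exact ⟨T, rfl, .zero T⟩
    · rintro ⟨X, rfl, hs⟩
      cases hs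
      exact .zero _
  | succ d ih =>
    constructor
    · intro hs
      cases hs with
      | succ hs hr =>
        obtain ⟨X, rfl, hX⟩ := ih.1 hs
        obtain ⟨Z, rfl, hZ⟩ := (hrot _ _).1 hr
        exact ⟨Z, rfl, .succ hX hZ⟩
    · rintro ⟨X, rfl, hs⟩
      cases hs with
      | succ hs hr => exact .succ (ih.2 ⟨_, rfl, hs⟩) ((hrot _ _).2 ⟨_, rfl, hr⟩)

/-! ### Runs of the algorithm -/

theorem Reached.forall_mem {S : Set (BinaryTree ℕ)} {T₀ : BinaryTree ℕ} {V : List (BinaryTree ℕ)}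
    (h₀ : T₀ ∈ S) (h : Reached S T₀ V) : ∀ T ∈ V, T ∈ S := by
  induction h with
  | init => simpa using h₀
  | step _ hs ih =>
    obtain ⟨_, _, hc, -⟩ := hs
    exact List.forall_mem_cons.2 ⟨hc.1, ih⟩

theorem Reached.nodup {S : Set (BinaryTree ℕ)} {T₀ : BinaryTree ℕ} {V : List (BinaryTree ℕ)}
    (h : Reached S T₀ V) : V.Nodup := by
  induction h with
  | init => simp
  | step _ hs ih =>
    obtain ⟨_, _, hc, -⟩ := hs
    exact List.nodup_cons.2 ⟨hc.2.1, ih⟩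

theorem Reached.of_append {S : Set (BinaryTree ℕ)} {T₀ : BinaryTree ℕ}
    {A B : List (BinaryTree ℕ)} (h : Reached S T₀ (A ++ B)) (hB : B ≠ []) : Reached S T₀ B := by
  induction A with
  | nil => exact h
  | cons a A ih =>
    refine ih ?_
    generalize hC : A ++ B = C at h
    rw [List.cons_append, hC] at h
    cases h with
    | init => simp_all
    | step h _ => exact h

theorem Step.unique {S : Set (BinaryTree ℕ)} {V : List (BinaryTree ℕ)} {T A B : BinaryTree ℕ}
    (hT : IsSearchTree T) (hA : Step S V T A) (hB : Step S V T B) : A = B := by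
  obtain ⟨j, dir, hcA, hmaxA, hdirA⟩ := hA
  obtain ⟨j', dir', hcB, hmaxB, -⟩ := hB
  obtain rfl := le_antisymm (hmaxA _ _ _ hcB) (hmaxB _ _ _ hcA)
  obtain rfl := hdirA _ _ hcB
  obtain ⟨hAS, -, d, hd, hsA, hminA⟩ := hcA
  obtain ⟨hBS, -, d', hd', hsB, hminB⟩ := hcB
  rcases lt_trichotomy d d' with h | rfl | h
  · exact absurd hAS (hminB d hd h _ hsA)
  · exact hsA.unique hT hsB
  · exact absurd hBS (hminA d' hd' h _ hsB)

/-- The algorithm is deterministic on search trees: everything that it does is a part of a given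
terminated run. -/
theorem Reached.suffix_of_output {S : Set (BinaryTree ℕ)} {T₀ : BinaryTree ℕ}
    {V W : List (BinaryTree ℕ)} (hS : ∀ T ∈ S, IsSearchTree T) (h₀ : T₀ ∈ S)
    (hV : Reached S T₀ V) (hW : Output S T₀ W) : V <:+ W := by
  induction hV with
  | init =>
    have h := hW.1
    clear hW
    induction h with
    | init => exact List.suffix_rfl
    | step _ _ ih => exact ih.trans (List.suffix_cons _ _)
  | @step T T' V hV hs ih =>
    obtain ⟨A, rfl⟩ := ih
    rcases List.eq_nil_or_concat A with rfl | ⟨A, T'', rfl⟩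
    · exact absurd ⟨T', hV.step hs⟩ hW.2
    · have h : Reached S T₀ (T'' :: T :: V) := by
        refine Reached.of_append (A := A) ?_ (by simp)
        simpa using hW.1
      cases h with
      | step _ hs' =>
        rw [hs.unique (hS _ (hV.forall_mem h₀ T (by simp))) hs']
        exact ⟨A, by simp⟩

theorem Output.unique {S : Set (BinaryTree ℕ)} {T₀ : BinaryTree ℕ} {V W : List (BinaryTree ℕ)}
    (hS : ∀ T ∈ S, IsSearchTree T) (h₀ : T₀ ∈ S) (hV : Output S T₀ V) (hW : Output S T₀ W) :
    V = W :=
  (hV.1.suffix_of_output hS h₀ hW).eq_of_length_le (hW.1.suffix_of_output hS h₀ hV).length_le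

/-! ### Sweeping the largest vertex along a right branch -/

theorem slide_sweep {dir : Dir} {N m : ℕ} {g : ℕ → BinaryTree ℕ}
    (hfwd : ∀ s X, s ≤ m → Rot dir N (g s) X → s < m ∧ X = g (s + 1))
    {s d : ℕ} {X : BinaryTree ℕ} (hs : s ≤ m) (h : Slide dir N d (g s) X) :
    s + d ≤ m ∧ X = g (s + d) := by
  induction d generalizing X with
  | zero => cases h; exact ⟨hs, rfl⟩
  | succ d ih =>
    cases h with
    | succ h hr =>
      obtain ⟨hd, rfl⟩ := ih h
      obtain ⟨hd', rfl⟩ := hfwd _ _ hd hr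
      exact ⟨hd', rfl⟩

theorem slide_sweep_back {dir : Dir} {N m : ℕ} {g : ℕ → BinaryTree ℕ}
    (hback : ∀ s X, s ≤ m → Rot dir N (g s) X → 0 < s ∧ X = g (s - 1))
    {s d : ℕ} {X : BinaryTree ℕ} (hs : s ≤ m) (h : Slide dir N d (g s) X) :
    d ≤ s ∧ X = g (s - d) := by
  induction d generalizing X with
  | zero => cases h; exact ⟨Nat.zero_le _, rfl⟩
  | succ d ih =>
    cases h with
    | succ h hr =>
      obtain ⟨hd, rfl⟩ := ih h
      obtain ⟨hd', rfl⟩ := hback _ _ (by omega) hr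
      exact ⟨by omega, by rw [Nat.sub_sub]⟩

theorem slide_sweep_exists {dir : Dir} {N m : ℕ} {g : ℕ → BinaryTree ℕ}
    (hex : ∀ s < m, Rot dir N (g s) (g (s + 1))) {s d : ℕ} (h : s + d ≤ m) :
    Slide dir N d (g s) (g (s + d)) := by
  induction d with
  | zero => exact .zero _
  | succ d ih => exact .succ (ih (by omega)) (hex _ (by omega))

/-- If the rotations of the largest vertex `N` move along the path `g 0, …, g m` only, and of these
trees just `g 0` has been visited, then the algorithm continues by visiting all trees of the path
that belong to `S`, in their order on the path. -/
theorem Reached.sweep {S : Set (BinaryTree ℕ)} {T₀ : BinaryTree ℕ} {V : List (BinaryTree ℕ)}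
    {dir : Dir} {N m : ℕ} {g : ℕ → BinaryTree ℕ}
    (hfwd : ∀ s X, s ≤ m → Rot dir N (g s) X → s < m ∧ X = g (s + 1))
    (hback : ∀ dir' ≠ dir, ∀ s X, s ≤ m → Rot dir' N (g s) X → 0 < s ∧ X = g (s - 1))
    (hex : ∀ s < m, Rot dir N (g s) (g (s + 1)))
    (hN : ∀ s ≤ m, ∀ j ∈ verts (g s), j ≤ N)
    (hinj : ∀ s ≤ m, ∀ s' ≤ m, g s = g s' → s = s')
    (hm : g m ∈ S) (hR : Reached S T₀ (g 0 :: V)) (h0 : g 0 ∈ S)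
    (hV : ∀ s ≤ m, g s ∉ V) :
    ∃ V', Reached S T₀ (g m :: V') ∧
      ∀ Y, Y ∈ g m :: V' ↔ Y ∈ V ∨ ∃ s ≤ m, Y = g s ∧ Y ∈ S := by
  -- the state of the algorithm once it has passed the first `t` trees after `g 0`
  have key : ∀ t ≤ m, ∃ s ≤ t, g s ∈ S ∧ (∀ r, s < r → r ≤ t → g r ∉ S) ∧
      ∃ V', Reached S T₀ (g s :: V') ∧
        ∀ Y, Y ∈ g s :: V' ↔ Y ∈ V ∨ ∃ r ≤ t, Y = g r ∧ Y ∈ S := by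
    intro t
    induction t with
    | zero =>
      refine fun _ => ⟨0, le_rfl, h0, fun r h1 h2 => by omega, V, hR, fun Y => ?_⟩
      rw [List.mem_cons, or_comm]
      refine or_congr_right ⟨?_, ?_⟩
      · rintro rfl
        exact ⟨0, le_rfl, rfl, h0⟩
      · rintro ⟨r, hr, rfl, -⟩
        rw [Nat.le_zero.1 hr]
    | succ t ih =>
      intro ht
      obtain ⟨s, hst, hsS, hmin, V', hV', hmem⟩ := ih (by omega)
      by_cases hS : g (t + 1) ∈ S
      · have hnew : g (t + 1) ∉ g s :: V' := by
          rw [hmem]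
          rintro (h | ⟨r, hr, h, -⟩)
          · exact hV _ ht h
          · have := hinj _ ht _ (by omega) h
            omega
        refine ⟨t + 1, le_rfl, hS, fun r h1 h2 => by omega, g s :: V',
          hV'.step ⟨N, dir, ⟨hS, hnew, t + 1 - s, by omega, ?_, ?_⟩, ?_, ?_⟩, fun Y => ?_⟩
        · have h := slide_sweep_exists hex (s := s) (d := t + 1 - s) (by omega)
          rwa [Nat.add_sub_cancel' (by omega : s ≤ t + 1)] at h
        · intro d hd hd' X hX
          obtain ⟨-, rfl⟩ := slide_sweep hfwd (by omega) hX
          exact hmin _ (by omega) (by omega)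
        · rintro j dir' X ⟨-, -, d, hd, hX, -⟩
          exact hN s (by omega) j (hX.mem hd)
        · -- a slide of `N` in the other direction leads back to a visited tree
          rintro dir' X ⟨hXS, hXV, d, hd, hX, -⟩
          by_contra hdir
          obtain ⟨hds, rfl⟩ := slide_sweep_back (hback dir' hdir) (by omega) hX
          exact hXV ((hmem _).2 (.inr ⟨s - d, by omega, rfl, hXS⟩))
        · rw [List.mem_cons, hmem]
          constructor
          · rintro (rfl | h | ⟨r, hr, h⟩)
            · exact .inr ⟨t + 1, le_rfl, rfl, hS⟩
            · exact .inl h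
            · exact .inr ⟨r, by omega, h⟩
          · rintro (h | ⟨r, hr, h⟩)
            · exact .inr (.inl h)
            · rcases Nat.lt_or_ge t r with h' | h'
              · exact .inl (h.1.trans (by rw [show r = t + 1 by omega]))
              · exact .inr (.inr ⟨r, h', h⟩)
      · refine ⟨s, by omega, hsS, fun r h1 h2 => ?_, V', hV', fun Y => ?_⟩
        · rcases Nat.lt_or_ge t r with h' | h'
          · rwa [show r = t + 1 by omega]
          · exact hmin r h1 h'
        · rw [hmem]
          refine or_congr_right ⟨?_, ?_⟩
          · rintro ⟨r, hr, h⟩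
            exact ⟨r, by omega, h⟩
          · rintro ⟨r, hr, rfl, h⟩
            refine ⟨r, ?_, rfl, h⟩
            by_contra h'
            exact hS (by rwa [show t + 1 = r by omega])
  obtain ⟨s, hs, hsS, hmin, h⟩ := key m le_rfl
  obtain rfl : s = m := by
    by_contra hne
    exact hmin m (by omega) le_rfl hm
  exact h

/-! ### Lifting a run along the insertion of the largest vertex -/

/-- The set `S` of trees on `n + 1` vertices is a zigzag extension of the set `S'` of trees on `n`
vertices: the deletion of the largest vertex maps `S` to `S'`, and for every tree in `S'` the
insertions of the vertex `n + 1` as the root and as a leaf belong to `S`. -/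
structure IsZigzagExtension (n : ℕ) (S' S : Set (BinaryTree ℕ)) : Prop where
  small : S' ⊆ binTrees n
  large : S ⊆ binTrees (n + 1)
  deleteMax_mem : ∀ T ∈ S, deleteMax T ∈ S'
  root_mem : ∀ T ∈ S', insertMax T (n + 1) 0 ∈ S
  leaf_mem : ∀ T ∈ S', insertMax T (n + 1) (branchLength T) ∈ S

namespace IsZigzagExtension

variable {n : ℕ} {S' S : Set (BinaryTree ℕ)} {T T₀ : BinaryTree ℕ} {V V' : List (BinaryTree ℕ)}

theorem notMem (hZ : IsZigzagExtension n S' S) (hT : T ∈ S') : n + 1 ∉ verts T := by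
  rw [(hZ.small hT).2]
  simp

theorem exists_eq (hZ : IsZigzagExtension n S' S) (hT : T ∈ S) :
    ∃ t ≤ branchLength (deleteMax T), T = insertMax (deleteMax T) (n + 1) t := by
  obtain ⟨T', t, ht, rfl, -⟩ := exists_eq_insertMax_of_mem (hZ.large hT)
  exact ⟨t, by rwa [deleteMax_insertMax], by rw [deleteMax_insertMax]⟩

theorem insertMax_le (hZ : IsZigzagExtension n S' S) (hT : T ∈ S') {t j : ℕ}
    (hj : j ∈ verts (insertMax T (n + 1) t)) : j ≤ n + 1 := by
  rw [(insertMax_mem t (hZ.small hT)).2, Finset.mem_Icc] at hj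
  exact hj.2

theorem exists_eq_of_rot (hZ : IsZigzagExtension n S' S) (hT : T ∈ S') {dir : Dir} {t : ℕ}
    (ht : t ≤ branchLength T) {X : BinaryTree ℕ}
    (h : Rot dir (n + 1) (insertMax T (n + 1) t) X) :
    ∃ t' ≤ branchLength T, X = insertMax T (n + 1) t' := by
  cases dir with
  | up => exact ⟨_, by omega, (eq_of_upRot_insertMax (hZ.notMem hT) ht h).2⟩
  | down =>
    have h := eq_of_upRot_insertMax_right (hZ.notMem hT) ht h
    exact ⟨_, h.1, h.2⟩

theorem exists_eq_of_slide (hZ : IsZigzagExtension n S' S) (hT : T ∈ S') {dir : Dir} {t d : ℕ}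
    (ht : t ≤ branchLength T) {X : BinaryTree ℕ}
    (h : Slide dir (n + 1) d (insertMax T (n + 1) t) X) :
    ∃ t' ≤ branchLength T, X = insertMax T (n + 1) t' := by
  induction d generalizing X with
  | zero => cases h; exact ⟨t, ht, rfl⟩
  | succ d ih =>
    cases h with
    | succ h hr =>
      obtain ⟨t', ht', rfl⟩ := ih h
      exact hZ.exists_eq_of_rot hT ht' hr

/-- Starting from a tree where `n + 1` is a leaf or the root, the algorithm visits all trees that
arise from the same tree on `n` vertices, and ends with `n + 1` at the root or as a leaf,
respectively. -/
theorem reached_block (hZ : IsZigzagExtension n S' S) (hT : T ∈ S') {t : ℕ}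
    (ht : t = 0 ∨ t = branchLength T) (hR : Reached S T₀ (insertMax T (n + 1) t :: V))
    (hV : ∀ s ≤ branchLength T, insertMax T (n + 1) s ∉ V) :
    ∃ t' V', (t' = 0 ∨ t' = branchLength T) ∧ Reached S T₀ (insertMax T (n + 1) t' :: V') ∧
      ∀ Y, Y ∈ insertMax T (n + 1) t' :: V' ↔ Y ∈ V ∨ (Y ∈ S ∧ deleteMax Y = T) := by
  have hblock : ∀ Y, (∃ s ≤ branchLength T, Y = insertMax T (n + 1) s ∧ Y ∈ S) ↔
      (Y ∈ S ∧ deleteMax Y = T) := by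
    intro Y
    constructor
    · rintro ⟨s, -, rfl, h⟩
      exact ⟨h, deleteMax_insertMax _ _ _⟩
    · rintro ⟨h, rfl⟩
      obtain ⟨s, hs, h'⟩ := hZ.exists_eq h
      exact ⟨s, hs, h', h⟩
  have hinj : ∀ s ≤ branchLength T, ∀ s' ≤ branchLength T,
      insertMax T (n + 1) s = insertMax T (n + 1) s' → s = s' := by
    intro s hs s' hs' h
    have := congrArg branchLength h
    rw [branchLength_insertMax hs, branchLength_insertMax hs'] at this
    omega
  have hn := hZ.notMem hT
  rcases ht with rfl | rfl
  · obtain ⟨V', h1, h2⟩ := Reached.sweep (dir := .down) (N := n + 1) (m := branchLength T)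
      (g := fun s => insertMax T (n + 1) s)
      (fun s X hs h => eq_of_upRot_insertMax_right hn hs h)
      (fun dir' hdir s X hs h => by
        cases dir' with
        | up => exact eq_of_upRot_insertMax hn hs h
        | down => exact absurd rfl hdir)
      (fun s hs => upRot_insertMax T _ hs)
      (fun s _ j hj => hZ.insertMax_le hT hj) hinj (hZ.leaf_mem T hT) hR (hZ.root_mem T hT) hV
    exact ⟨_, V', .inr rfl, h1, fun Y => (h2 Y).trans (or_congr_right (hblock Y))⟩
  · obtain ⟨V', h1, h2⟩ := Reached.sweep (dir := .up) (N := n + 1) (m := branchLength T)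
      (g := fun s => insertMax T (n + 1) (branchLength T - s))
      (fun s X hs h => by
        have h := eq_of_upRot_insertMax hn (by omega) h
        exact ⟨by omega, by rw [h.2, Nat.sub_sub]⟩)
      (fun dir' hdir s X hs h => by
        cases dir' with
        | up => exact absurd rfl hdir
        | down =>
          have h := eq_of_upRot_insertMax_right hn (by omega) h
          exact ⟨by omega, by
            rw [h.2, show branchLength T - (s - 1) = branchLength T - s + 1 by omega]⟩)
      (fun s hs => by
        have h := upRot_insertMax T (n + 1) (t := branchLength T - (s + 1)) (by omega)
        rwa [show branchLength T - (s + 1) + 1 = branchLength T - s by omega] at h)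
      (fun s _ j hj => hZ.insertMax_le hT hj)
      (fun s hs s' hs' h => by
        have := hinj _ (Nat.sub_le _ _) _ (Nat.sub_le _ _) h
        omega)
      (by simpa using hZ.root_mem T hT) hR (hZ.leaf_mem T hT) (fun s _ => hV _ (Nat.sub_le _ _))
    refine ⟨0, V', .inl rfl, by simpa using h1, fun Y => ?_⟩
    rw [← hblock Y]
    have h := h2 Y
    simp only [Nat.sub_self] at h
    rw [h]
    refine or_congr_right ⟨?_, ?_⟩
    · rintro ⟨s, -, h⟩
      exact ⟨_, Nat.sub_le _ _, h⟩
    · rintro ⟨s, hs, h⟩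
      exact ⟨branchLength T - s, Nat.sub_le _ _, by rwa [Nat.sub_sub_self hs]⟩

/-- While `n + 1` is the root or a leaf, its slides lead to visited trees only, and the slides of
the other vertices are those of the tree without `n + 1`. -/
theorem step_lift (hZ : IsZigzagExtension n S' S) {T' : BinaryTree ℕ}
    {h : BinaryTree ℕ → BinaryTree ℕ}
    {t : ℕ} (ht : t ≤ branchLength T) (hht : h T = insertMax T (n + 1) t)
    (hrot : ∀ dir, ∀ j ≠ n + 1, ∀ T Y, Rot dir j (h T) Y ↔ ∃ X, Y = h X ∧ Rot dir j T X)
    (hdel : ∀ X, deleteMax (h X) = X) (hmem : ∀ X ∈ S', h X ∈ S)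
    (hV : ∀ Y, Y ∈ V ↔ Y ∈ S ∧ deleteMax Y ∈ V') (hT : T ∈ S') (hTV : T ∈ V')
    (hs : Step S' V' T T') : Step S V (h T) (h T') := by
  have hS : ∀ X, h X ∈ S ↔ X ∈ S' := fun X =>
    ⟨fun hX => hdel X ▸ hZ.deleteMax_mem _ hX, hmem X⟩
  have hne : ∀ j dir Y, Candidate S V (h T) j dir Y → j ≠ n + 1 := by
    rintro _ dir Y ⟨hYS, hYV, d, hd, hY, -⟩ rfl
    rw [hht] at hY
    obtain ⟨t', -, rfl⟩ := hZ.exists_eq_of_slide hT ht hY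
    exact hYV ((hV _).2 ⟨hYS, by rwa [deleteMax_insertMax]⟩)
  have hcand : ∀ j dir Y, j ≠ n + 1 →
      (Candidate S V (h T) j dir Y ↔ ∃ X, Y = h X ∧ Candidate S' V' T j dir X) := by
    intro j dir Y hj
    have hslide : ∀ d Y, Slide dir j d (h T) Y ↔ ∃ X, Y = h X ∧ Slide dir j d T X :=
      fun d Y => slide_iff_of_rot_iff (hrot dir j hj)
    constructor
    · rintro ⟨hYS, hYV, d, hd, hY, hmin⟩
      obtain ⟨X, rfl, hX⟩ := (hslide d Y).1 hY
      refine ⟨X, rfl, (hS X).1 hYS, fun hXV => hYV ((hV _).2 ⟨hYS, by rwa [hdel]⟩), d, hd, hX, ?_⟩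
      intro d' h1 h2 X' hX' hXS
      exact hmin d' h1 h2 (h X') ((hslide d' _).2 ⟨X', rfl, hX'⟩) (hmem X' hXS)
    · rintro ⟨X, rfl, hXS, hXV, d, hd, hX, hmin⟩
      refine ⟨hmem X hXS, fun hV' => hXV (hdel X ▸ ((hV _).1 hV').2), d, hd,
        (hslide d _).2 ⟨X, rfl, hX⟩, ?_⟩
      intro d' h1 h2 Y' hY' hYS
      obtain ⟨X', rfl, hX'⟩ := (hslide d' Y').1 hY'
      exact hmin d' h1 h2 X' hX' ((hS X').1 hYS)
  obtain ⟨j, dir, hc, hmax, hdir⟩ := hs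
  have hj : j ≠ n + 1 := by
    obtain ⟨-, -, d, hd, hX, -⟩ := hc
    rintro rfl
    exact hZ.notMem hT (hX.mem hd)
  refine ⟨j, dir, (hcand j dir _ hj).2 ⟨T', rfl, hc⟩, fun j' dir' Y hY => ?_, fun dir' Y hY => ?_⟩
  · obtain ⟨X, -, hX⟩ := (hcand j' dir' Y (hne _ _ _ hY)).1 hY
    exact hmax _ _ _ hX
  · obtain ⟨X, -, hX⟩ := (hcand j dir' Y hj).1 hY
    exact hdir _ _ hX

/-- Every state `V'` of the algorithm on `S'` lifts to the state of the algorithm on `S` in which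
the visited trees are those that arise from the trees in `V'`. -/
theorem reached_lift (hZ : IsZigzagExtension n S' S) (h₀ : T₀ ∈ S') (hR : Reached S' T₀ V') :
    ∃ T V₁ t V, V' = T :: V₁ ∧ (t = 0 ∨ t = branchLength T) ∧
      Reached S (insertMax T₀ (n + 1) (branchLength T₀)) (insertMax T (n + 1) t :: V) ∧
      ∀ Y, Y ∈ insertMax T (n + 1) t :: V ↔ Y ∈ S ∧ deleteMax Y ∈ V' := by
  induction hR with
  | init =>
    obtain ⟨t, V, ht, h1, h2⟩ := hZ.reached_block h₀ (V := []) (.inr rfl) .init (by simp)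
    exact ⟨T₀, [], t, V, rfl, ht, h1, fun Y => by simpa using h2 Y⟩
  | @step T T' V₁ hR hs ih =>
    obtain ⟨T, _, t, V, heq, ht, h1, h2⟩ := ih
    cases heq
    have hT : T ∈ S' := hR.forall_mem h₀ T (by simp)
    have hT' : T' ∈ S' ∧ T' ∉ T :: V₁ := by
      obtain ⟨_, _, hc, -⟩ := hs
      exact ⟨hc.1, hc.2.1⟩
    obtain ⟨t₂, ht₂, hstep⟩ : ∃ t₂, (t₂ = 0 ∨ t₂ = branchLength T') ∧
        Step S (insertMax T (n + 1) t :: V) (insertMax T (n + 1) t)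
          (insertMax T' (n + 1) t₂) := by
      rcases ht with rfl | rfl
      · exact ⟨0, .inl rfl, hZ.step_lift (h := fun X => insertMax X (n + 1) 0) (Nat.zero_le _) rfl
          (fun dir j hj T Y => rot_insertMax_zero hj) (fun X => deleteMax_insertMax _ _ _)
          hZ.root_mem h2 hT (by simp) hs⟩
      · exact ⟨_, .inr rfl, hZ.step_lift (h := fun X => insertMax X (n + 1) (branchLength X))
          le_rfl rfl (fun dir j hj T Y => rot_insertMax_branchLength hj)
          (fun X => deleteMax_insertMax _ _ _) hZ.leaf_mem h2 hT (by simp) hs⟩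
    obtain ⟨t₃, V₃, ht₃, h3, h4⟩ := hZ.reached_block hT'.1 ht₂ (h1.step hstep) (fun s _ h => by
      have := ((h2 _).1 h).2
      rw [deleteMax_insertMax] at this
      exact hT'.2 this)
    refine ⟨T', _, t₃, V₃, rfl, ht₃, h3, fun Y => ?_⟩
    rw [h4, h2, List.mem_cons (a := deleteMax Y) (b := T'), ← and_or_left, or_comm]

end IsZigzagExtension

/-- A sequence of zigzag extensions that starts with the empty tree is generated by the
algorithm. -/
theorem exists_reached_of_isZigzagExtension {S : ℕ → Set (BinaryTree ℕ)} (h0 : S 0 = {.nil})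
    (hZ : ∀ n, IsZigzagExtension n (S n) (S (n + 1))) (n : ℕ) :
    rightPath n ∈ S n ∧ ∃ V, Reached (S n) (rightPath n) V ∧ ∀ T, T ∈ V ↔ T ∈ S n := by
  induction n with
  | zero =>
    refine ⟨by rw [h0]; rfl, [rightPath 0], .init, fun T => ?_⟩
    rw [h0, List.mem_singleton, Set.mem_singleton_iff]
    rfl
  | succ n ih =>
    obtain ⟨hmem, V', hR, hV'⟩ := ih
    obtain ⟨T, -, t, V, -, -, h1, h2⟩ := (hZ n).reached_lift hmem hR
    rw [rightPath_succ]
    refine ⟨(hZ n).leaf_mem _ hmem, _, h1, fun Y => ?_⟩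
    rw [h2, hV', and_iff_left_iff_imp]
    exact (hZ n).deleteMax_mem Y

/-! ### Subtrees of search trees -/

theorem subtreeAt_node_self (x : ℕ) (l r : BinaryTree ℕ) :
    subtreeAt (.node x l r) x = .node x l r := by
  simp [subtreeAt]

theorem subtreeAt_node_of_lt {x i : ℕ} (l r : BinaryTree ℕ) (h : i < x) :
    subtreeAt (.node x l r) i = subtreeAt l i := by
  simp [subtreeAt, h, h.ne]

theorem subtreeAt_node_of_gt {x i : ℕ} (l r : BinaryTree ℕ) (h : x < i) :
    subtreeAt (.node x l r) i = subtreeAt r i := by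
  simp [subtreeAt, h.ne', h.not_gt]

theorem verts_subtreeAt_subset (T : BinaryTree ℕ) (i : ℕ) : verts (subtreeAt T i) ⊆ verts T := by
  induction T with
  | nil => simp [subtreeAt]
  | node x l r ihl ihr =>
    intro y hy
    rcases lt_trichotomy i x with h | rfl | h
    · rw [subtreeAt_node_of_lt _ _ h] at hy
      simp [verts, ihl hy]
    · rwa [subtreeAt_node_self] at hy
    · rw [subtreeAt_node_of_gt _ _ h] at hy
      simp [verts, ihr hy]

theorem verts_left_subset (T : BinaryTree ℕ) : verts T.left ⊆ verts T := by
  cases T with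
  | nil => exact subset_rfl
  | node x l r => intro y hy; exact Finset.mem_insert_of_mem (Finset.mem_union_left _ hy)

theorem verts_right_subset (T : BinaryTree ℕ) : verts T.right ⊆ verts T := by
  cases T with
  | nil => exact subset_rfl
  | node x l r => intro y hy; exact Finset.mem_insert_of_mem (Finset.mem_union_right _ hy)

theorem verts_leftSub_subset (T : BinaryTree ℕ) (i : ℕ) : verts (leftSub T i) ⊆ verts T :=
  (verts_left_subset _).trans (verts_subtreeAt_subset _ _)

theorem verts_rightSub_subset (T : BinaryTree ℕ) (i : ℕ) : verts (rightSub T i) ⊆ verts T :=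
  (verts_right_subset _).trans (verts_subtreeAt_subset _ _)

theorem subtreeAt_of_notMem {T : BinaryTree ℕ} {i : ℕ} (h : i ∉ verts T) :
    subtreeAt T i = .nil := by
  induction T with
  | nil => rfl
  | node x l r ihl ihr =>
    simp only [verts, Finset.mem_insert, Finset.mem_union, not_or] at h
    rw [subtreeAt, if_neg h.1, ihl h.2.1, ihr h.2.2, ite_self]

theorem root_mem_verts {T : BinaryTree ℕ} {x : ℕ} (h : root T = some x) : x ∈ verts T := by
  cases T with
  | nil => cases h
  | node => cases h; simp [verts]

theorem lt_of_mem_leftSub {T : BinaryTree ℕ} (hT : IsSearchTree T) {a v : ℕ}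
    (h : v ∈ verts (leftSub T a)) : v < a := by
  induction T with
  | nil => simp [leftSub, subtreeAt, BinaryTree.left, verts] at h
  | node x l r ihl ihr =>
    rw [leftSub] at h
    rcases lt_trichotomy a x with h' | rfl | h'
    · rw [subtreeAt_node_of_lt _ _ h'] at h
      exact ihl hT.1 h
    · rw [subtreeAt_node_self] at h
      exact hT.2.2.1 v h
    · rw [subtreeAt_node_of_gt _ _ h'] at h
      exact ihr hT.2.1 h

theorem lt_of_mem_rightSub {T : BinaryTree ℕ} (hT : IsSearchTree T) {a v : ℕ}
    (h : v ∈ verts (rightSub T a)) : a < v := by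
  induction T with
  | nil => simp [rightSub, subtreeAt, BinaryTree.right, verts] at h
  | node x l r ihl ihr =>
    rw [rightSub] at h
    rcases lt_trichotomy a x with h' | rfl | h'
    · rw [subtreeAt_node_of_lt _ _ h'] at h
      exact ihl hT.1 h
    · rw [subtreeAt_node_self] at h
      exact hT.2.2.2 v h
    · rw [subtreeAt_node_of_gt _ _ h'] at h
      exact ihr hT.2.1 h

theorem subtreeAt_of_mem_leftSub {T : BinaryTree ℕ} (hT : IsSearchTree T) {a v : ℕ}
    (h : v ∈ verts (leftSub T a)) : subtreeAt T v = subtreeAt (leftSub T a) v := by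
  induction T with
  | nil => simp [leftSub, subtreeAt, BinaryTree.left, verts] at h
  | node x l r ihl ihr =>
    obtain ⟨hl, hr, hlx, hrx⟩ := hT
    rw [leftSub] at h ⊢
    rcases lt_trichotomy a x with h' | rfl | h'
    · rw [subtreeAt_node_of_lt _ _ h'] at h ⊢
      rw [subtreeAt_node_of_lt _ _ (hlx v (verts_leftSub_subset l a h))]
      exact ihl hl h
    · rw [subtreeAt_node_self] at h ⊢
      exact subtreeAt_node_of_lt _ _ (hlx v h)
    · rw [subtreeAt_node_of_gt _ _ h'] at h ⊢
      rw [subtreeAt_node_of_gt _ _ (hrx v (verts_leftSub_subset r a h))]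
      exact ihr hr h

theorem subtreeAt_of_mem_rightSub {T : BinaryTree ℕ} (hT : IsSearchTree T) {a v : ℕ}
    (h : v ∈ verts (rightSub T a)) : subtreeAt T v = subtreeAt (rightSub T a) v := by
  induction T with
  | nil => simp [rightSub, subtreeAt, BinaryTree.right, verts] at h
  | node x l r ihl ihr =>
    obtain ⟨hl, hr, hlx, hrx⟩ := hT
    rw [rightSub] at h ⊢
    rcases lt_trichotomy a x with h' | rfl | h'
    · rw [subtreeAt_node_of_lt _ _ h'] at h ⊢
      rw [subtreeAt_node_of_lt _ _ (hlx v (verts_rightSub_subset l a h))]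
      exact ihl hl h
    · rw [subtreeAt_node_self] at h ⊢
      exact subtreeAt_node_of_gt _ _ (hrx v h)
    · rw [subtreeAt_node_of_gt _ _ h'] at h ⊢
      rw [subtreeAt_node_of_gt _ _ (hrx v (verts_rightSub_subset r a h))]
      exact ihr hr h

theorem verts_subtreeAt_subset_leftSub {T : BinaryTree ℕ} (hT : IsSearchTree T) {a v : ℕ}
    (h : v ∈ verts (leftSub T a)) : verts (subtreeAt T v) ⊆ verts (leftSub T a) :=
  subtreeAt_of_mem_leftSub hT h ▸ verts_subtreeAt_subset _ _

theorem verts_subtreeAt_subset_rightSub {T : BinaryTree ℕ} (hT : IsSearchTree T) {a v : ℕ}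
    (h : v ∈ verts (rightSub T a)) : verts (subtreeAt T v) ⊆ verts (rightSub T a) :=
  subtreeAt_of_mem_rightSub hT h ▸ verts_subtreeAt_subset _ _

theorem leftSub_node_self (x : ℕ) (l r : BinaryTree ℕ) : leftSub (.node x l r) x = l := by
  rw [leftSub, subtreeAt_node_self]
  rfl

theorem rightSub_node_self (x : ℕ) (l r : BinaryTree ℕ) : rightSub (.node x l r) x = r := by
  rw [rightSub, subtreeAt_node_self]
  rfl

theorem leftSub_node_of_lt {x i : ℕ} (l r : BinaryTree ℕ) (h : i < x) :
    leftSub (.node x l r) i = leftSub l i := by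
  rw [leftSub, subtreeAt_node_of_lt _ _ h, leftSub]

theorem rightSub_node_of_lt {x i : ℕ} (l r : BinaryTree ℕ) (h : i < x) :
    rightSub (.node x l r) i = rightSub l i := by
  rw [rightSub, subtreeAt_node_of_lt _ _ h, rightSub]

theorem leftSub_node_of_gt {x i : ℕ} (l r : BinaryTree ℕ) (h : x < i) :
    leftSub (.node x l r) i = leftSub r i := by
  rw [leftSub, subtreeAt_node_of_gt _ _ h, leftSub]

theorem rightSub_node_of_gt {x i : ℕ} (l r : BinaryTree ℕ) (h : x < i) :
    rightSub (.node x l r) i = rightSub r i := by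
  rw [rightSub, subtreeAt_node_of_gt _ _ h, rightSub]

theorem mem_of_mem_leftSub {T : BinaryTree ℕ} {a v : ℕ} (h : v ∈ verts (leftSub T a)) :
    a ∈ verts T := by
  by_contra ha
  rw [leftSub, subtreeAt_of_notMem ha] at h
  simp [BinaryTree.left, verts] at h

theorem mem_of_mem_rightSub {T : BinaryTree ℕ} {a v : ℕ} (h : v ∈ verts (rightSub T a)) :
    a ∈ verts T := by
  by_contra ha
  rw [rightSub, subtreeAt_of_notMem ha] at h
  simp [BinaryTree.right, verts] at h

theorem root_notMem_leftSub {T : BinaryTree ℕ} (hT : IsSearchTree T) {x : ℕ}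
    (h : root T = some x) (a : ℕ) : x ∉ verts (leftSub T a) := by
  cases T with
  | nil => cases h
  | node y l r =>
    cases h
    obtain ⟨-, -, hl, hr⟩ := hT
    intro hx
    rcases lt_trichotomy a x with h | rfl | h
    · rw [leftSub_node_of_lt _ _ h] at hx
      exact lt_irrefl _ (hl x (verts_leftSub_subset _ _ hx))
    · rw [leftSub_node_self] at hx
      exact lt_irrefl _ (hl a hx)
    · rw [leftSub_node_of_gt _ _ h] at hx
      exact lt_irrefl _ (hr x (verts_leftSub_subset _ _ hx))

theorem root_notMem_rightSub {T : BinaryTree ℕ} (hT : IsSearchTree T) {x : ℕ}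
    (h : root T = some x) (a : ℕ) : x ∉ verts (rightSub T a) := by
  cases T with
  | nil => cases h
  | node y l r =>
    cases h
    obtain ⟨-, -, hl, hr⟩ := hT
    intro hx
    rcases lt_trichotomy a x with h | rfl | h
    · rw [rightSub_node_of_lt _ _ h] at hx
      exact lt_irrefl _ (hl x (verts_rightSub_subset _ _ hx))
    · rw [rightSub_node_self] at hx
      exact lt_irrefl _ (hr a hx)
    · rw [rightSub_node_of_gt _ _ h] at hx
      exact lt_irrefl _ (hr x (verts_rightSub_subset _ _ hx))

theorem parent_unique_of_rightChild {T : BinaryTree ℕ} (hT : IsSearchTree T) {q q' i : ℕ}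
    (h : rightChild T q = some i) (h' : rightChild T q' = some i) : q = q' := by
  induction T with
  | nil => simp [rightChild, rightSub, subtreeAt, BinaryTree.right, root] at h
  | node x l r ihl ihr =>
    obtain ⟨hl, hr, hlx, hrx⟩ := hT
    rw [rightChild] at h h'
    rcases lt_trichotomy q x with hq | hq | hq <;> rcases lt_trichotomy q' x with hq' | hq' | hq'
    · rw [rightSub_node_of_lt _ _ hq] at h
      rw [rightSub_node_of_lt _ _ hq'] at h'
      exact ihl hl h h'
    · subst hq'
      rw [rightSub_node_of_lt _ _ hq] at h
      rw [rightSub_node_self] at h'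
      exact absurd (hlx i (verts_rightSub_subset _ _ (root_mem_verts h)))
        (hrx i (root_mem_verts h')).not_gt
    · rw [rightSub_node_of_lt _ _ hq] at h
      rw [rightSub_node_of_gt _ _ hq'] at h'
      exact absurd (hlx i (verts_rightSub_subset _ _ (root_mem_verts h)))
        (hrx i (verts_rightSub_subset _ _ (root_mem_verts h'))).not_gt
    · subst hq
      rw [rightSub_node_self] at h
      rw [rightSub_node_of_lt _ _ hq'] at h'
      exact absurd (hlx i (verts_rightSub_subset _ _ (root_mem_verts h')))
        (hrx i (root_mem_verts h)).not_gt
    · exact hq.trans hq'.symm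
    · subst hq
      rw [rightSub_node_self] at h
      rw [rightSub_node_of_gt _ _ hq'] at h'
      exact absurd (root_mem_verts h') (root_notMem_rightSub hr h q')
    · rw [rightSub_node_of_gt _ _ hq] at h
      rw [rightSub_node_of_lt _ _ hq'] at h'
      exact absurd (hlx i (verts_rightSub_subset _ _ (root_mem_verts h')))
        (hrx i (verts_rightSub_subset _ _ (root_mem_verts h))).not_gt
    · subst hq'
      rw [rightSub_node_of_gt _ _ hq] at h
      rw [rightSub_node_self] at h'
      exact absurd (root_mem_verts h) (root_notMem_rightSub hr h' q)
    · rw [rightSub_node_of_gt _ _ hq] at h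
      rw [rightSub_node_of_gt _ _ hq'] at h'
      exact ihr hr h h'

/-- Two vertices of a search tree are in an ancestor relation, or they are separated by a vertex
that has one of them on its left and the other one on its right. -/
theorem mem_sub_of_lt {T : BinaryTree ℕ} (hT : IsSearchTree T) {v w : ℕ} (hv : v ∈ verts T)
    (hw : w ∈ verts T) (h : v < w) :
    v ∈ verts (leftSub T w) ∨ w ∈ verts (rightSub T v) ∨
      ∃ a, v ∈ verts (leftSub T a) ∧ w ∈ verts (rightSub T a) := by
  induction T with
  | nil => simp [verts] at hv
  | node x l r ihl ihr =>
    obtain ⟨hl, hr, hlx, hrx⟩ := hT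
    simp only [verts, Finset.mem_insert, Finset.mem_union] at hv hw
    rcases hv with rfl | hv | hv
    · have hw : w ∈ verts r := by
        rcases hw with rfl | hw | hw
        · omega
        · have := hlx w hw
          omega
        · exact hw
      exact .inr (.inl (by rwa [rightSub_node_self]))
    · rcases hw with rfl | hw | hw
      · exact .inl (by rwa [leftSub_node_self])
      · have hvx := hlx v hv
        have hwx := hlx w hw
        rw [leftSub_node_of_lt _ _ hwx, rightSub_node_of_lt _ _ hvx]
        refine (ihl hl hv hw).imp_right (Or.imp_right ?_)
        rintro ⟨a, h1, h2⟩
        have hax := hlx a (mem_of_mem_leftSub h1)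
        exact ⟨a, by rwa [leftSub_node_of_lt _ _ hax], by rwa [rightSub_node_of_lt _ _ hax]⟩
      · exact .inr (.inr ⟨x, by rwa [leftSub_node_self], by rwa [rightSub_node_self]⟩)
    · have hvx := hrx v hv
      have hw : w ∈ verts r := by
        rcases hw with rfl | hw | hw
        · omega
        · have := hlx w hw
          omega
        · exact hw
      have hwx := hrx w hw
      rw [leftSub_node_of_gt _ _ hwx, rightSub_node_of_gt _ _ hvx]
      refine (ihr hr hv hw).imp_right (Or.imp_right ?_)
      rintro ⟨a, h1, h2⟩
      have hax := hrx a (mem_of_mem_leftSub h1)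
      exact ⟨a, by rwa [leftSub_node_of_gt _ _ hax], by rwa [rightSub_node_of_gt _ _ hax]⟩

/-! ### The right branch -/

theorem rightBranch_subset_verts {T : BinaryTree ℕ} {v : ℕ} (h : v ∈ rightBranch T) :
    v ∈ verts T := by
  induction T with
  | nil => simp [rightBranch] at h
  | node x l r _ ih =>
    simp only [rightBranch, List.mem_cons, verts, Finset.mem_insert, Finset.mem_union] at h ⊢
    tauto

theorem notMem_leftSub_of_mem_rightBranch {T : BinaryTree ℕ} (hT : IsSearchTree T) {v : ℕ}
    (h : v ∈ rightBranch T) (a : ℕ) : v ∉ verts (leftSub T a) := by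
  induction T with
  | nil => simp [rightBranch] at h
  | node x l r _ ih =>
    obtain ⟨hl, hr, hlx, hrx⟩ := hT
    have hxv : x ≤ v := by
      rcases List.mem_cons.1 h with rfl | h
      · exact le_rfl
      · exact (hrx v (rightBranch_subset_verts h)).le
    intro hv
    rcases lt_trichotomy a x with h' | rfl | h'
    · rw [leftSub_node_of_lt _ _ h'] at hv
      exact hxv.not_gt (hlx v (verts_leftSub_subset _ _ hv))
    · rw [leftSub_node_self] at hv
      exact hxv.not_gt (hlx v hv)
    · rw [leftSub_node_of_gt _ _ h'] at hv
      rcases List.mem_cons.1 h with rfl | h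
      · exact lt_irrefl _ (hrx v (verts_leftSub_subset _ _ hv))
      · exact ih hr h hv

theorem mem_rightBranch {T : BinaryTree ℕ} (hT : IsSearchTree T) {v : ℕ} (hv : v ∈ verts T)
    (h : ∀ a, v ∉ verts (leftSub T a)) : v ∈ rightBranch T := by
  induction T with
  | nil => simp [verts] at hv
  | node x l r _ ih =>
    obtain ⟨hl, hr, hlx, hrx⟩ := hT
    simp only [verts, Finset.mem_insert, Finset.mem_union] at hv
    rcases hv with rfl | hv | hv
    · exact List.mem_cons_self
    · exact absurd (by rwa [leftSub_node_self]) (h x)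
    · refine List.mem_cons_of_mem _ (ih hr hv fun a ha => h a ?_)
      rwa [leftSub_node_of_gt _ _ (hrx a (mem_of_mem_leftSub ha))]

theorem rightBranch_ne_nil {T : BinaryTree ℕ} {v : ℕ} (h : v ∈ verts T) : rightBranch T ≠ [] := by
  cases T with
  | nil => simp [verts] at h
  | node => simp [rightBranch]

theorem mem_dropLast_rightBranch {T : BinaryTree ℕ} (hT : IsSearchTree T) {v w : ℕ}
    (hv : v ∈ rightBranch T) (hw : w ∈ verts T) (h : v < w) :
    v ∈ (rightBranch T).dropLast := by
  induction T with
  | nil => simp [verts] at hw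
  | node x l r _ ih =>
    obtain ⟨hl, hr, hlx, hrx⟩ := hT
    have hxv : x ≤ v := by
      rcases List.mem_cons.1 hv with rfl | h
      · exact le_rfl
      · exact (hrx v (rightBranch_subset_verts h)).le
    have hw : w ∈ verts r := by
      simp only [verts, Finset.mem_insert, Finset.mem_union] at hw
      rcases hw with rfl | hw | hw
      · omega
      · have := hlx w hw
        omega
      · exact hw
    rw [rightBranch, List.dropLast_cons_of_ne_nil (rightBranch_ne_nil hw)]
    rcases List.mem_cons.1 hv with rfl | hv
    · exact List.mem_cons_self
    · exact List.mem_cons_of_mem _ (ih hr hv hw)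

/-! ### Subtrees after the insertion of the largest vertex -/

/-- The insertion of the largest vertex `n` affects the subtree of a smaller vertex `q` only if `q`
lies on the right branch above `n`. -/
theorem subtreeAt_insertMax (T : BinaryTree ℕ) {n q : ℕ} (t : ℕ) (hq : q < n) :
    subtreeAt (insertMax T n t) q = subtreeAt T q ∨
      ∃ l r s, subtreeAt T q = .node q l r ∧
        subtreeAt (insertMax T n t) q = .node q l (insertMax r n s) ∧
        ∀ v ∈ rightBranch r, v ∈ rightBranch T := by
  induction T generalizing t with
  | nil => cases t <;> exact .inl (by simp [insertMax, subtreeAt, hq, hq.ne])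
  | node x l r _ ih =>
    cases t with
    | zero => exact .inl (by rw [insertMax_zero, subtreeAt_node_of_lt _ _ hq])
    | succ t =>
      rw [insertMax]
      rcases lt_trichotomy q x with h | rfl | h
      · exact .inl (by rw [subtreeAt_node_of_lt _ _ h, subtreeAt_node_of_lt _ _ h])
      · refine .inr ⟨l, r, t, subtreeAt_node_self _ _ _, subtreeAt_node_self _ _ _, ?_⟩
        exact fun v hv => List.mem_cons_of_mem _ hv
      · rw [subtreeAt_node_of_gt _ _ h, subtreeAt_node_of_gt _ _ h]
        refine (ih t).imp_right ?_
        rintro ⟨l', r', s, h1, h2, h3⟩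
        exact ⟨l', r', s, h1, h2, fun v hv => List.mem_cons_of_mem _ (h3 v hv)⟩

theorem leftSub_insertMax (T : BinaryTree ℕ) {n q : ℕ} (t : ℕ) (hq : q < n) :
    leftSub (insertMax T n t) q = leftSub T q := by
  rw [leftSub, leftSub]
  rcases subtreeAt_insertMax T t hq with h | ⟨l, r, s, h1, h2, -⟩
  · rw [h]
  · rw [h1, h2]
    rfl

theorem rightSub_insertMax (T : BinaryTree ℕ) {n q : ℕ} (t : ℕ) (hq : q < n) :
    rightSub (insertMax T n t) q = rightSub T q ∨
      ∃ s, rightSub (insertMax T n t) q = insertMax (rightSub T q) n s ∧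
        ∀ v ∈ rightBranch (rightSub T q), v ∈ rightBranch T := by
  rw [rightSub, rightSub]
  rcases subtreeAt_insertMax T t hq with h | ⟨l, r, s, h1, h2, h3⟩
  · rw [h]
    exact .inl rfl
  · rw [h1, h2]
    exact .inr ⟨s, rfl, h3⟩

theorem verts_rightSub_insertMax (T : BinaryTree ℕ) {n q v : ℕ} (t : ℕ) (hq : q < n)
    (hv : v ≠ n) : v ∈ verts (rightSub (insertMax T n t) q) ↔ v ∈ verts (rightSub T q) := by
  rcases rightSub_insertMax T t hq with h | ⟨s, h, -⟩
  · rw [h]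
  · rw [h, verts_insertMax, Finset.mem_insert, or_iff_right hv]

theorem root_insertMax_of_ne {T : BinaryTree ℕ} {n t x : ℕ} (h : root (insertMax T n t) = some x)
    (hx : x ≠ n) : root T = some x := by
  cases t with
  | zero => rw [insertMax_zero] at h; cases h; exact absurd rfl hx
  | succ t =>
    cases T with
    | nil => cases h; exact absurd rfl hx
    | node => exact h

theorem leftSub_insertMax_branchLength {T : BinaryTree ℕ} {n : ℕ} (hT : ∀ y ∈ verts T, y < n) :
    leftSub (insertMax T n (branchLength T)) n = .nil := by
  induction T with
  | nil => exact leftSub_node_self _ _ _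
  | node x l r _ ih =>
    rw [branchLength, insertMax, leftSub_node_of_gt _ _ (hT x (by simp [verts]))]
    exact ih fun y hy => hT y (by simp [verts, hy])

/-! ### Embeddings of patterns -/

/-- The map `f` sends left and right children in `P` to left and right descendants in `T`,
respectively. -/
def MapsChildren (f : ℕ → ℕ) (P T : BinaryTree ℕ) : Prop :=
  (∀ q i, leftChild P q = some i → f i ∈ verts (leftSub T (f q))) ∧
    ∀ q i, rightChild P q = some i → f i ∈ verts (rightSub T (f q))

theorem MapsChildren.mem_sub {f : ℕ → ℕ} {P T : BinaryTree ℕ} (hP : IsSearchTree P)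
    (hT : IsSearchTree T) (h : MapsChildren f P T) (a v : ℕ) :
    (v ∈ verts (leftSub P a) → f v ∈ verts (leftSub T (f a))) ∧
      (v ∈ verts (rightSub P a) → f v ∈ verts (rightSub T (f a))) := by
  induction P generalizing a v with
  | nil => simp [leftSub, rightSub, subtreeAt, BinaryTree.left, BinaryTree.right, verts]
  | node x l r ihl ihr =>
    obtain ⟨hl, hr, hlx, hrx⟩ := hP
    have ihl := ihl hl ⟨fun q i hq => h.1 q i (by
      rwa [leftChild, leftSub_node_of_lt _ _ (hlx q (mem_of_mem_leftSub (root_mem_verts hq)))]),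
      fun q i hq => h.2 q i (by
      rwa [rightChild,
        rightSub_node_of_lt _ _ (hlx q (mem_of_mem_rightSub (root_mem_verts hq)))])⟩
    have ihr := ihr hr ⟨fun q i hq => h.1 q i (by
      rwa [leftChild, leftSub_node_of_gt _ _ (hrx q (mem_of_mem_leftSub (root_mem_verts hq)))]),
      fun q i hq => h.2 q i (by
      rwa [rightChild,
        rightSub_node_of_gt _ _ (hrx q (mem_of_mem_rightSub (root_mem_verts hq)))])⟩
    rcases lt_trichotomy a x with ha | rfl | ha
    · rw [leftSub_node_of_lt _ _ ha, rightSub_node_of_lt _ _ ha]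
      exact ihl a v
    · rw [leftSub_node_self, rightSub_node_self]
      constructor
      · intro hv
        cases l with
        | nil => simp [verts] at hv
        | node y b c =>
          have hy := h.1 a y (by rw [leftChild, leftSub_node_self]; rfl)
          have hsub := verts_subtreeAt_subset_leftSub hT hy
          have hyv := ihl y v
          rw [leftSub_node_self, rightSub_node_self] at hyv
          simp only [verts, Finset.mem_insert, Finset.mem_union] at hv
          rcases hv with rfl | hv | hv
          · exact hy
          · exact hsub (verts_left_subset _ (hyv.1 hv))
          · exact hsub (verts_right_subset _ (hyv.2 hv))
      · intro hv
        cases r with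
        | nil => simp [verts] at hv
        | node y b c =>
          have hy := h.2 a y (by rw [rightChild, rightSub_node_self]; rfl)
          have hsub := verts_subtreeAt_subset_rightSub hT hy
          have hyv := ihr y v
          rw [leftSub_node_self, rightSub_node_self] at hyv
          simp only [verts, Finset.mem_insert, Finset.mem_union] at hv
          rcases hv with rfl | hv | hv
          · exact hy
          · exact hsub (verts_left_subset _ (hyv.1 hv))
          · exact hsub (verts_right_subset _ (hyv.2 hv))
    · rw [leftSub_node_of_gt _ _ ha, rightSub_node_of_gt _ _ ha]
      exact ihr a v

theorem MapsChildren.lt {f : ℕ → ℕ} {P T : BinaryTree ℕ} (hP : IsSearchTree P)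
    (hT : IsSearchTree T) (h : MapsChildren f P T) {v w : ℕ} (hv : v ∈ verts P) (hw : w ∈ verts P)
    (hvw : v < w) : f v < f w := by
  have hsub := h.mem_sub hP hT
  rcases mem_sub_of_lt hP hv hw hvw with h | h | ⟨a, h1, h2⟩
  · exact lt_of_mem_leftSub hT ((hsub _ _).1 h)
  · exact lt_of_mem_rightSub hT ((hsub _ _).2 h)
  · exact (lt_of_mem_leftSub hT ((hsub _ _).1 h1)).trans (lt_of_mem_rightSub hT ((hsub _ _).2 h2))

/-- `f` satisfies the conditions on the edges of the pattern `p` for an embedding in `T`. -/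
def PreservesEdges (f : ℕ → ℕ) (p : TreePattern) (T : BinaryTree ℕ) : Prop :=
  (∀ q i, leftChild p.P q = some i →
    if p.contig i then leftChild T (f q) = some (f i) else f i ∈ verts (leftSub T (f q))) ∧
  (∀ q i, rightChild p.P q = some i →
    if p.contig i then rightChild T (f q) = some (f i) else f i ∈ verts (rightSub T (f q)))

theorem PreservesEdges.mapsChildren {f : ℕ → ℕ} {p : TreePattern} {T : BinaryTree ℕ}
    (h : PreservesEdges f p T) : MapsChildren f p.P T := by
  refine ⟨fun q i hi => ?_, fun q i hi => ?_⟩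
  · have := h.1 q i hi
    split_ifs at this
    · exact root_mem_verts this
    · exact this
  · have := h.2 q i hi
    split_ifs at this
    · exact root_mem_verts this
    · exact this

theorem TreePattern.le_k (p : TreePattern) {v : ℕ} (hv : v ∈ verts p.P) : v ≤ p.k := by
  rw [p.mem.2, Finset.mem_Icc] at hv
  exact hv.2

theorem Friendly.k_mem {p : TreePattern} (hp : Friendly p) : p.k ∈ verts p.P := by
  obtain ⟨q, h | h⟩ := hp.parent_ne
  · exact verts_leftSub_subset _ _ (root_mem_verts h)
  · exact verts_rightSub_subset _ _ (root_mem_verts h)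

/-- If no vertex of the pattern is mapped to the largest vertex `n`, then the occurrence of the
pattern survives the deletion of `n`. -/
theorem contains_of_contains_insertMax {p : TreePattern} {T : BinaryTree ℕ} {n t : ℕ} {f : ℕ → ℕ}
    (hT : ∀ y ∈ verts T, y < n) (hmap : Set.MapsTo f (verts p.P) (verts (insertMax T n t)))
    (hinj : Set.InjOn f (verts p.P)) (hf : PreservesEdges f p (insertMax T n t))
    (hn : ∀ v ∈ verts p.P, f v ≠ n) : Contains T p := by
  have hmem : ∀ v ∈ verts p.P, f v ∈ verts T := by
    intro v hv
    have h := hmap hv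
    rw [Finset.mem_coe, verts_insertMax, Finset.mem_insert] at h
    exact h.resolve_left (hn v hv)
  refine ⟨f, hmem, hinj, fun q i hi => ?_, fun q i hi => ?_⟩
  · have hq := hT _ (hmem q (mem_of_mem_leftSub (root_mem_verts hi)))
    have h := hf.1 q i hi
    rwa [leftChild, leftSub_insertMax T t hq] at h
  · have hq := hT _ (hmem q (mem_of_mem_rightSub (root_mem_verts hi)))
    have hin := hn i (verts_rightSub_subset _ _ (root_mem_verts hi))
    have h := hf.2 q i hi
    rw [verts_rightSub_insertMax T t hq hin] at h
    split_ifs at h ⊢ with hc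
    · rw [rightChild] at h ⊢
      rcases rightSub_insertMax T t hq with h' | ⟨s, h', -⟩
      · rwa [h'] at h
      · rw [h'] at h
        exact root_insertMax_of_ne h hin
    · exact h

/-- Only the largest vertex of a pattern can be mapped to the largest vertex of a tree. -/
theorem PreservesEdges.eq_k {p : TreePattern} (hp : Friendly p) {T : BinaryTree ℕ} {n v : ℕ}
    {f : ℕ → ℕ} (hT : IsSearchTree T) (hmax : ∀ y ∈ verts T, y ≤ n)
    (hmap : Set.MapsTo f (verts p.P) (verts T)) (hf : PreservesEdges f p T) (hv : v ∈ verts p.P)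
    (hfv : f v = n) : v = p.k := by
  by_contra hne
  have h := hf.mapsChildren.lt p.mem.1 hT hv hp.k_mem (lt_of_le_of_ne (p.le_k hv) hne)
  have := hmax _ (hmap hp.k_mem)
  omega

/-- As the largest vertex of a friendly pattern is not its root, inserting the largest vertex as
the root of a tree does not create an occurrence. -/
theorem Friendly.contains_of_contains_insertMax_zero {p : TreePattern} (hp : Friendly p)
    {T : BinaryTree ℕ} {n : ℕ} (hs : IsSearchTree T) (hT : ∀ y ∈ verts T, y < n)
    (h : Contains (insertMax T n 0) p) : Contains T p := by
  obtain ⟨f, hmap, hinj, hf⟩ := h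
  have hf : PreservesEdges f p (insertMax T n 0) := hf
  have hs' := isSearchTree_insertMax 0 hs hT
  refine contains_of_contains_insertMax hT hmap hinj hf fun v hv hfv => ?_
  have hroot : root (insertMax T n 0) = some n := by rw [insertMax_zero]; rfl
  obtain rfl := hf.eq_k hp hs' (fun y hy => by
    rw [verts_insertMax, Finset.mem_insert] at hy
    exact hy.elim Eq.le fun hy => (hT y hy).le) hmap hv hfv
  obtain ⟨q, h | h⟩ := hp.parent_ne
  · exact root_notMem_leftSub hs' hroot (f q) (hfv ▸ hf.mapsChildren.1 q _ h)
  · exact root_notMem_rightSub hs' hroot (f q) (hfv ▸ hf.mapsChildren.2 q _ h)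

/-- As the largest vertex of a friendly pattern has a left child, inserting the largest vertex as
a leaf of a tree does not create an occurrence. -/
theorem Friendly.contains_of_contains_insertMax_branchLength {p : TreePattern} (hp : Friendly p)
    {T : BinaryTree ℕ} {n : ℕ} (hs : IsSearchTree T) (hT : ∀ y ∈ verts T, y < n)
    (h : Contains (insertMax T n (branchLength T)) p) : Contains T p := by
  obtain ⟨f, hmap, hinj, hf⟩ := h
  have hf : PreservesEdges f p (insertMax T n (branchLength T)) := hf
  have hs' := isSearchTree_insertMax (branchLength T) hs hT
  refine contains_of_contains_insertMax hT hmap hinj hf fun v hv hfv => ?_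
  obtain rfl := hf.eq_k hp hs' (fun y hy => by
    rw [verts_insertMax, Finset.mem_insert] at hy
    exact hy.elim Eq.le fun hy => (hT y hy).le) hmap hv hfv
  obtain ⟨c, hc⟩ := Option.ne_none_iff_exists'.1 hp.leftChild_ne
  have h := hf.mapsChildren.1 _ c hc
  rw [hfv, leftSub_insertMax_branchLength hT] at h
  simp [verts] at h

/-- The insertion of `n` breaks at most one edge of an occurrence of a friendly pattern that has to
be preserved, namely the edge between the largest vertex `k` and its parent. -/
theorem Friendly.rightChild_insertMax {p : TreePattern} (hp : Friendly p) {T : BinaryTree ℕ}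
    {n t : ℕ} {f : ℕ → ℕ} (hs : IsSearchTree T) (hT : ∀ y ∈ verts T, y < n)
    (hmap : Set.MapsTo f (verts p.P) (verts T)) (hf : PreservesEdges f p T) {q i : ℕ}
    (hi : rightChild p.P q = some i) (hc : p.contig i = true) :
    rightChild (insertMax T n t) (f q) = some (f i) ∨
      (i = p.k ∧ rightSub (insertMax T n t) (f q) = .node n (rightSub T (f q)) .nil) := by
  have hq := hT _ (hmap (mem_of_mem_rightSub (root_mem_verts hi)))
  have hfi : root (rightSub T (f q)) = some (f i) := by simpa [hc, rightChild] using hf.2 q i hi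
  rcases rightSub_insertMax T t hq with h | ⟨s, h, hb⟩
  · exact .inl (by rw [rightChild, h, hfi])
  · cases s with
    | succ s =>
      left
      rw [rightChild, h]
      generalize rightSub T (f q) = R at hfi
      cases R with
      | nil => cases hfi
      | node => exact hfi
    | zero =>
      right
      refine ⟨?_, by rw [h, insertMax_zero]⟩
      have hiP : i ∈ verts p.P := verts_rightSub_subset _ _ (root_mem_verts hi)
      have hfb : f i ∈ rightBranch T := by
        refine hb _ ?_
        generalize rightSub T (f q) = R at hfi
        cases R with
        | nil => cases hfi
        | node => cases hfi; exact List.mem_cons_self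
      -- as `f` preserves left descendants, `i` lies on the right branch of the pattern
      have hib : i ∈ rightBranch p.P := mem_rightBranch p.mem.1 hiP fun a ha =>
        notMem_leftSub_of_mem_rightBranch hs hfb (f a)
          ((hf.mapsChildren.mem_sub p.mem.1 hs a i).1 ha)
      by_contra hik
      have hd := mem_dropLast_rightBranch p.mem.1 hib hp.k_mem
        (lt_of_le_of_ne (p.le_k hiP) hik)
      have hr : root p.P ≠ some i := fun hr =>
        root_notMem_rightSub p.mem.1 hr q (root_mem_verts hi)
      rw [hp.branch i hd hr] at hc
      cases hc

/-- The insertion of a new largest vertex preserves the containment of a friendly pattern: if it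
breaks the edge between the largest vertex `k` and its parent, then the new vertex, which has the
former image of `k` in its left subtree, can serve as the image of `k`. -/
theorem Friendly.contains_insertMax {p : TreePattern} (hp : Friendly p) {T : BinaryTree ℕ}
    {n : ℕ} (t : ℕ) (hs : IsSearchTree T) (hT : ∀ y ∈ verts T, y < n) (h : Contains T p) :
    Contains (insertMax T n t) p := by
  obtain ⟨f, hmap, hinj, hf⟩ := h
  have hf : PreservesEdges f p T := hf
  have hs' := isSearchTree_insertMax t hs hT
  have hlt : ∀ v ∈ verts p.P, f v < n := fun v hv => hT _ (hmap hv)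
  have hleft : ∀ q i, leftChild p.P q = some i → if p.contig i then
      leftChild (insertMax T n t) (f q) = some (f i) else
      f i ∈ verts (leftSub (insertMax T n t) (f q)) := by
    intro q i hi
    rw [leftChild, leftSub_insertMax T t (hlt q (mem_of_mem_leftSub (root_mem_verts hi)))]
    exact hf.1 q i hi
  have hright : ∀ q i, rightChild p.P q = some i → p.contig i = false →
      f i ∈ verts (rightSub (insertMax T n t) (f q)) := by
    intro q i hi hc
    rw [verts_rightSub_insertMax T t (hlt q (mem_of_mem_rightSub (root_mem_verts hi)))
      (hlt i (verts_rightSub_subset _ _ (root_mem_verts hi))).ne]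
    exact hf.mapsChildren.2 q i hi
  by_cases hbroken : ∃ q, rightChild p.P q = some p.k ∧ p.contig p.k = true ∧
      rightSub (insertMax T n t) (f q) = .node n (rightSub T (f q)) .nil
  · obtain ⟨q₀, hq₀, hck, hsub⟩ := hbroken
    have hn : subtreeAt (insertMax T n t) n = .node n (rightSub T (f q₀)) .nil := by
      rw [subtreeAt_of_mem_rightSub hs' (a := f q₀) (by rw [hsub]; simp [verts]), hsub,
        subtreeAt_node_self]
    set g : ℕ → ℕ := fun v => if v = p.k then n else f v with hg
    have hgk : g p.k = n := by simp [hg]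
    have hgv : ∀ v ≠ p.k, g v = f v := fun v hv => by simp [hg, hv]
    refine ⟨g, ?_, ?_, ?_, ?_⟩
    · intro v hv
      rw [Finset.mem_coe, verts_insertMax, Finset.mem_insert]
      by_cases h : v = p.k
      · exact .inl (by rw [h, hgk])
      · exact .inr (by rw [hgv v h]; exact hmap hv)
    · intro v hv w hw hvw
      by_cases h : v = p.k <;> by_cases h' : w = p.k
      · rw [h, h']
      · rw [h, hgk, hgv w h'] at hvw
        exact absurd hvw.symm (hlt w hw).ne
      · rw [h', hgk, hgv v h] at hvw
        exact absurd hvw (hlt v hv).ne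
      · rw [hgv v h, hgv w h'] at hvw
        exact hinj hv hw hvw
    · intro q i hi
      have hiq := lt_of_mem_leftSub p.mem.1 (root_mem_verts hi)
      have hqk := p.le_k (mem_of_mem_leftSub (root_mem_verts hi))
      rw [hgv i (by omega)]
      by_cases h : q = p.k
      · subst h
        have hc := hp.last hck i hi
        have hmem : f i ∈ verts (rightSub T (f q₀)) :=
          verts_subtreeAt_subset_rightSub hs (hf.mapsChildren.2 _ _ hq₀)
            (verts_left_subset _ (hf.mapsChildren.1 _ _ hi))
        rw [hc, hgk, leftSub, hn]
        simpa using hmem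
      · rw [hgv q h]
        exact hleft q i hi
    · intro q i hi
      have hiq := lt_of_mem_rightSub p.mem.1 (root_mem_verts hi)
      have hik := p.le_k (verts_rightSub_subset _ _ (root_mem_verts hi))
      rw [hgv q (by omega)]
      by_cases h : i = p.k
      · subst h
        obtain rfl := parent_unique_of_rightChild p.mem.1 hi hq₀
        rw [if_pos hck, hgk, rightChild, hsub]
        rfl
      · rw [hgv i h]
        split_ifs with hc
        · exact (hp.rightChild_insertMax hs hT hmap hf hi hc).resolve_right fun h' => h h'.1
        · exact hright q i hi (by simpa using hc)
  · refine ⟨f, fun v hv => ?_, hinj, hleft, fun q i hi => ?_⟩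
    · rw [Finset.mem_coe, verts_insertMax]
      exact Finset.mem_insert_of_mem (hmap hv)
    · split_ifs with hc
      · refine (hp.rightChild_insertMax hs hT hmap hf hi hc).resolve_right ?_
        rintro ⟨rfl, h⟩
        exact hbroken ⟨q, hi, hc, h⟩
      · exact hright q i hi (by simpa using hc)

/-! ### Avoiding friendly patterns -/

theorem avoiders_zero {l : ℕ} {p : Fin l → TreePattern} (hp : ∀ i, Friendly (p i)) :
    avoiders 0 p = {.nil} := by
  ext T
  rw [Set.mem_singleton_iff]
  constructor
  · rintro ⟨⟨-, h⟩, -⟩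
    cases T with
    | nil => rfl
    | node x l r =>
      have hx : x ∈ Finset.Icc 1 0 := h ▸ by simp [verts]
      simp at hx
  · rintro rfl
    refine ⟨⟨trivial, rfl⟩, ?_⟩
    rintro i ⟨f, hmap, -⟩
    have := hmap (hp i).k_mem
    simp [verts] at this

theorem isZigzagExtension_avoiders (n : ℕ) {l : ℕ} {p : Fin l → TreePattern}
    (hp : ∀ i, Friendly (p i)) : IsZigzagExtension n (avoiders n p) (avoiders (n + 1) p) := by
  have hlt : ∀ T ∈ binTrees n, ∀ y ∈ verts T, y < n + 1 := by
    intro T hT y hy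
    rw [hT.2, Finset.mem_Icc] at hy
    omega
  refine ⟨fun T hT => hT.1, fun T hT => hT.1, fun T hT => ?_, fun T hT => ?_, fun T hT => ?_⟩
  · obtain ⟨T', t, -, rfl, hT'⟩ := exists_eq_insertMax_of_mem hT.1
    rw [deleteMax_insertMax]
    exact ⟨hT', fun i h => hT.2 i ((hp i).contains_insertMax t hT'.1 (hlt _ hT') h)⟩
  · exact ⟨insertMax_mem _ hT.1, fun i h =>
      hT.2 i ((hp i).contains_of_contains_insertMax_zero hT.1.1 (hlt _ hT.1) h)⟩
  · exact ⟨insertMax_mem _ hT.1, fun i h =>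
      hT.2 i ((hp i).contains_of_contains_insertMax_branchLength hT.1.1 (hlt _ hT.1) h)⟩

end PatTree

theorem mainTheorem2 (n l : ℕ) (p : Fin l → PatTree.TreePattern)
    (hp : ∀ i, PatTree.Friendly (p i)) :
    (∃ V, PatTree.Output (PatTree.avoiders n p) (PatTree.rightPath n) V) ∧
    ∀ V, PatTree.Output (PatTree.avoiders n p) (PatTree.rightPath n) V →
      V.Nodup ∧ ∀ T, T ∈ V ↔ T ∈ PatTree.avoiders n p := by
  obtain ⟨h₀, W, hW, hmem⟩ := PatTree.exists_reached_of_isZigzagExtension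
    (S := fun n => PatTree.avoiders n p) (PatTree.avoiders_zero hp)
    (fun n => PatTree.isZigzagExtension_avoiders n hp) n
  have hout : PatTree.Output (PatTree.avoiders n p) (PatTree.rightPath n) W := by
    -- all trees have been visited, so there is none that the next step could visit
    refine ⟨hW, fun ⟨T, hT⟩ => ?_⟩
    exact (List.nodup_cons.1 hT.nodup).1 ((hmem T).2 (hT.forall_mem h₀ T (by simp)))
  refine ⟨⟨W, hout⟩, fun V hV => ?_⟩
  obtain rfl := hV.unique (fun T hT => hT.1.1) h₀ hout
  exact ⟨hW.nodup, hmem⟩
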